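/- **Theorem.** Let $n\ge 3$ and $0<m<1$. Let $\xi:[0,\infty)\to\mathbb{R}^n$, $k:[0,\infty)\to\mathbb{R}$, $u_0:\mathbb{R}^n\setminus\{\xi(0)\}\to\mathbb{R}$, and let $\lambda,\mu,\nu$ be real numbers with $$0<\lambda<\mu<n-2<\nu .$$ Assume that one of the following holds: * (standing singularity) $m>\frac{n-2}{n}$ and $\xi$ is constant; or * (moving singularity) $m>\frac{n-2}{n-1}$, $\lambda>\frac{n-2}{m}-1$, $\xi\in C^1([0,\infty);\mathbb{R}^n)$, $\xi'$ is locally Hölder continuous, and there are constants $\Xi,\beta>0$ with $|\xi'(t)|\le \Xi e^{-\beta t}$ for all $t\ge 0$. Assume also that $k\in C^1([0,\infty))$ and that, for some constants $\kappa,\kappa'>0$, $\kappa^{-1}\le k(t)\le\kappa$ and $|k'(t)|\le\kappa'$ for all $t\ge0$; and that $u_0\in C(\mathbb{R}^n\setminus\{\xi(0)\})$ is positive, satisfies $$u_0(x)^m=k(0)^m|x-\xi(0)|^{2-n}+O(|x-\xi(0)|^{-\lambda})\quad\text{as }x\to\xi(0),$$ and, for some constant $C>1$, $C^{-1}|x-\xi(0)|^{-\nu}\le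 u_0(x)^m\le C|x-\xi(0)|^{-\mu}$ whenever $|x-\xi(0)|\ge1$. Let $u_1,u_2$ be two functions such that each $u\in\{u_1,u_2\}$ is positive on $\{(x,t):x\ne\xi(t),\ t\ge0\}$ and satisfies: 1. $u\in C^{2,1}(\{(x,t):x\neq\xi(t),\ t>0\})\cap C(\{(x,t):x\ne\xi(t),\ t\ge0\})$, $u_t=\Delta u^m$ pointwise for $x\ne\xi(t)$, $t>0$, and $u(x,0)=u_0(x)$ for $x\neq\xi(0)$; 2. $u\in C([0,\infty);L^1_{loc}(\mathbb{R}^n))$; 3. for each $t\ge0$, $u(x,t)^m=k(t)^m|x-\xi(t)|^{2-n}+O(|x-\xi(t)|^{-\lambda})$ as $x\to\xi(t)$ (the constant in $O$ and the neighbourhood may depend on $t$ and on $u$). If $u_1(\cdot,0)=u_2(\cdot,0)$ on $\mathbb{R}^n\setminus\{\xi(0)\}$, then $u_1(x,t)=u_2(x,t)$ for all $t>0$ and all $x\ne\xi(t)$. -/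

import Mathlib

open Set Filter Topology MeasureTheory Asymptotics InnerProductSpace
open scoped NNReal

/-- The standing case: `m > (n-2)/n` and the curve is constant on `[0, ∞)`. -/
def IsStandingCurve (n : ℕ) (m : ℝ) (ξ : ℝ → EuclideanSpace ℝ (Fin n)) : Prop :=
  ((n : ℝ) - 2) / n < m ∧ ∃ ξ₀ : EuclideanSpace ℝ (Fin n), ∀ t : ℝ, 0 ≤ t → ξ t = ξ₀

/-- The moving case: `m > (n-2)/(n-1)`, the curve is `C¹` on `[0, ∞)`, its derivative is locally
Hölder continuous and decays exponentially. The derivative at `0` is the right derivative. -/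
structure IsMovingCurve (n : ℕ) (m : ℝ) (ξ : ℝ → EuclideanSpace ℝ (Fin n)) : Prop where
  exponent : ((n : ℝ) - 2) / ((n : ℝ) - 1) < m
  contDiffOn : ContDiffOn ℝ 1 ξ (Ici 0)
  holder : ∀ T : ℝ, 0 < T → ∃ C α : ℝ≥0, 0 < α ∧ α ≤ 1 ∧
    HolderOnWith C α (derivWithin ξ (Ici 0)) (Icc 0 T)
  decay : ∃ Ξ β : ℝ, 0 < Ξ ∧ 0 < β ∧
    ∀ t : ℝ, 0 ≤ t → ‖derivWithin ξ (Ici 0) t‖ ≤ Ξ * Real.exp (-β * t)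

/-- The conditions on the strength `k` of the singularity: `k ∈ C¹([0, ∞))`, `k` is bounded
between two positive constants, and `k'` is bounded. -/
structure IsStrength (k : ℝ → ℝ) : Prop where
  contDiffOn : ContDiffOn ℝ 1 k (Ici 0)
  bounds : ∃ κ : ℝ, 0 < κ ∧ ∀ t : ℝ, 0 ≤ t → κ⁻¹ ≤ k t ∧ k t ≤ κ
  deriv_bound : ∃ κ' : ℝ, 0 < κ' ∧ ∀ t : ℝ, 0 ≤ t → |derivWithin k (Ici 0) t| ≤ κ'

/-- The asymptotic behaviour `w(x)^m = a^m |x - p|^{2-n} + O(|x - p|^{-lam})` as `x → p`. -/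
def HasSingularAsymptotics {n : ℕ} (m a lam : ℝ) (p : EuclideanSpace ℝ (Fin n))
    (w : EuclideanSpace ℝ (Fin n) → ℝ) : Prop :=
  (fun x => w x ^ m - a ^ m * ‖x - p‖ ^ (2 - (n : ℝ))) =O[𝓝[≠] p] fun x => ‖x - p‖ ^ (-lam)

/-- The conditions on the initial function `u₀`, with singular point `p` and strength `a`. -/
structure IsInitialDatum {n : ℕ} (m a lam μ ν : ℝ) (p : EuclideanSpace ℝ (Fin n))
    (u₀ : EuclideanSpace ℝ (Fin n) → ℝ) : Prop where
  continuousOn : ContinuousOn u₀ {p}ᶜ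
  pos : ∀ x, x ≠ p → 0 < u₀ x
  asymptotics : HasSingularAsymptotics m a lam p u₀
  far : ∃ C : ℝ, 1 < C ∧ ∀ x, 1 ≤ ‖x - p‖ →
    C⁻¹ * ‖x - p‖ ^ (-ν) ≤ u₀ x ^ m ∧ u₀ x ^ m ≤ C * ‖x - p‖ ^ (-μ)

/-- `u ∈ C^{2,1}(Ω)` for an open set `Ω` of space-time: the derivatives of `u` of order at most
two in space and of order one in time exist and are continuous on `Ω`. -/
structure IsC21On {n : ℕ} (Ω : Set (EuclideanSpace ℝ (Fin n) × ℝ))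
    (u : EuclideanSpace ℝ (Fin n) → ℝ → ℝ) : Prop where
  space : ∀ p ∈ Ω, ContDiffAt ℝ 2 (fun y => u y p.2) p.1
  time : ∀ p ∈ Ω, DifferentiableAt ℝ (fun s => u p.1 s) p.2
  continuousOn : ContinuousOn (fun p : EuclideanSpace ℝ (Fin n) × ℝ => u p.1 p.2) Ω
  continuousOn_fderiv : ContinuousOn
    (fun p : EuclideanSpace ℝ (Fin n) × ℝ => fderiv ℝ (fun y => u y p.2) p.1) Ω
  continuousOn_fderiv_two : ContinuousOn
    (fun p : EuclideanSpace ℝ (Fin n) × ℝ => iteratedFDeriv ℝ 2 (fun y => u y p.2) p.1) Ω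
  continuousOn_deriv : ContinuousOn
    (fun p : EuclideanSpace ℝ (Fin n) × ℝ => deriv (fun s => u p.1 s) p.2) Ω

/-- `u ∈ C([0, ∞); L¹_loc(ℝⁿ))`. -/
structure IsContinuousInL1Loc {n : ℕ} (u : EuclideanSpace ℝ (Fin n) → ℝ → ℝ) : Prop where
  locallyIntegrable : ∀ t : ℝ, 0 ≤ t → LocallyIntegrable (fun x => u x t) volume
  tendsto : ∀ K : Set (EuclideanSpace ℝ (Fin n)), IsCompact K → ∀ t : ℝ, 0 ≤ t →
    Tendsto (fun s => ∫ x in K, |u x s - u x t|) (𝓝[Ici 0] t) (𝓝 0)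

/-- Positive classical solutions of `u_t = Δ u^m` off the curve `x = ξ(t)` with initial function
`u₀`, in `C([0, ∞); L¹_loc)`, with the prescribed singular asymptotics at every time `t ≥ 0`.
The values `u (ξ t) t` are irrelevant. -/
structure IsSingularSolution {n : ℕ} (m lam : ℝ) (ξ : ℝ → EuclideanSpace ℝ (Fin n)) (k : ℝ → ℝ)
    (u₀ : EuclideanSpace ℝ (Fin n) → ℝ) (u : EuclideanSpace ℝ (Fin n) → ℝ → ℝ) : Prop where
  pos : ∀ t : ℝ, 0 ≤ t → ∀ x, x ≠ ξ t → 0 < u x t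
  regular : IsC21On {p | p.1 ≠ ξ p.2 ∧ 0 < p.2} u
  continuousOn : ContinuousOn (fun p : EuclideanSpace ℝ (Fin n) × ℝ => u p.1 p.2)
    {p | p.1 ≠ ξ p.2 ∧ 0 ≤ p.2}
  equation : ∀ t : ℝ, 0 < t → ∀ x, x ≠ ξ t →
    deriv (fun s => u x s) t = Laplacian.laplacian (fun y => u y t ^ m) x
  initial : ∀ x, x ≠ ξ 0 → u x 0 = u₀ x
  continuousL1Loc : IsContinuousInL1Loc u
  asymptotics : ∀ t : ℝ, 0 ≤ t → HasSingularAsymptotics m (k t) lam (ξ t) (fun x => u x t)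

/-! The proof is an `L¹` contraction argument in the style of Herrero and Pierre, with extra work to
show that the singular curve contributes nothing. Let `Φ(t) = ∫ |u₁ - u₂| ψ_R`, where `ψ_R` is a
cutoff at scale `R`. Away from the curve, Kato's inequality bounds the growth of `Φ` by `∫ |u₁^m -
u₂^m| |Δψ_R|`. By Jensen's inequality this is at most `C R^(n(1-m)-2) Φ^m`, provided `|Δψ| ≤ C ψ^m`.

To reach the curve, remove a ball of radius `ε` around `ξ(t)` and go back from `t` by the intrinsic
time `h = ε^e`, `e = n - (n-2)/m`, which is also the order of the mass of the singular profile on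
the annulus of radius `ε`. Two errors appear. The mass left in the ball at time `t` is
`O(ε^(e+n-2-lam)) = o(h)`, because the profiles have the same leading term. The other error is the
flux through the annulus at the times `τ ∈ [t-h, t]`, and here the asymptotics are not uniform in
`τ`. Two bounds replace uniformity: - at every `τ` in the window the flux is at most a constant `C₃`
independent of `t`, since the annular mass at time `t` controls the mass backward
(`exists_backward_bound`, `exists_flux_bound`); - at times where the asymptotics hold with constant
`N`, the flux is `O(N ε^(n-2-lam))`, hence small (`exists_flux_small`).

The remaining times form a set `V N` with measure tending to zero. The criterion
`le_of_left_increments_le` turns the estimates for small left increments into `Φ(t) ≤ ∫₀ᵗ C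
R^(n(1-m)-2) Φ^m + C₃ |V N|`, and `N → ∞` removes the last term (`exists_integral_abs_sub_le`).
Hence `Φ ≤ (T C R^(n(1-m)-2))^(1/(1-m))` on `[0, T]`, which tends to zero as `R → ∞` because `m >
(n-2)/n`. -/

/-! ### Inequalities for the power `m`, and a one-sided monotonicity criterion. -/

theorem abs_rpow_sub_rpow_le {m a b : ℝ} (hm₀ : 0 < m) (hm₁ : m ≤ 1) (ha : 0 ≤ a) (hb : 0 ≤ b) :
    |a ^ m - b ^ m| ≤ |a - b| ^ m := by
  wlog h : b ≤ a generalizing a b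
  · rw [abs_sub_comm, abs_sub_comm a b]
    exact this hb ha (le_of_not_ge h)
  have h1 := Real.rpow_add_le_add_rpow (sub_nonneg.2 h) hb hm₀.le hm₁
  rw [sub_add_cancel] at h1
  rw [abs_of_nonneg (sub_nonneg.2 h),
    abs_of_nonneg (sub_nonneg.2 (Real.rpow_le_rpow hb h hm₀.le))]
  linarith

/-- A mean value inequality for `s ↦ s^(1/m)`, obtained from `b^m a^(1-m) ≤ m b + (1-m) a`. It
converts the known closeness of `u₁^m` and `u₂^m` near the singularity into closeness of `u₁` and
`u₂`. -/
theorem abs_sub_le_mul_abs_rpow_sub_rpow {m a b M : ℝ} (hm₀ : 0 < m) (hm₁ : m ≤ 1)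
    (ha : 0 < a) (hb : 0 < b) (haM : a ≤ M) (hbM : b ≤ M) :
    |a - b| ≤ m⁻¹ * M ^ (1 - m) * |a ^ m - b ^ m| := by
  wlog h : b ≤ a generalizing a b
  · rw [abs_sub_comm, abs_sub_comm (a ^ m)]
    exact this hb ha hbM haM (le_of_not_ge h)
  have h0 : 0 ≤ a ^ m - b ^ m := sub_nonneg.2 (Real.rpow_le_rpow hb.le h hm₀.le)
  have h1 := Real.geom_mean_le_arith_mean2_weighted hm₀.le (sub_nonneg.2 hm₁) hb.le ha.le
    (by ring)
  have h2 : a ^ (1 - m) * a ^ m = a := by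
    rw [← Real.rpow_add ha]; simp
  have h3 : a ^ (1 - m) ≤ M ^ (1 - m) := Real.rpow_le_rpow ha.le haM (by linarith)
  rw [abs_of_nonneg (sub_nonneg.2 h), abs_of_nonneg h0]
  calc a - b = m⁻¹ * (m * (a - b)) := by field_simp
    _ ≤ m⁻¹ * (a ^ (1 - m) * (a ^ m - b ^ m)) := by
      refine mul_le_mul_of_nonneg_left ?_ (by positivity)
      rw [mul_sub (a ^ (1 - m)), h2]
      linarith
    _ ≤ m⁻¹ * (M ^ (1 - m) * (a ^ m - b ^ m)) := by gcongr
    _ = _ := by ring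

theorem rpow_le_one_add {m a : ℝ} (hm₀ : 0 ≤ m) (hm₁ : m ≤ 1) (ha : 0 ≤ a) : a ^ m ≤ 1 + a := by
  have := Real.geom_mean_le_arith_mean2_weighted hm₀ (sub_nonneg.2 hm₁) ha zero_le_one (by ring)
  rw [Real.one_rpow] at this
  nlinarith

theorem MeasureTheory.IntegrableOn.rpow_of_le_one {α : Type*} [MeasurableSpace α] {μ : Measure α}
    {K : Set α} (hK : μ K ≠ ⊤) {m : ℝ} (hm₀ : 0 < m) (hm₁ : m ≤ 1) {v : α → ℝ}
    (hv₀ : ∀ x, 0 ≤ v x) (hv : IntegrableOn v K μ) : IntegrableOn (fun x => v x ^ m) K μ := by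
  have h1 : IntegrableOn (fun x => 1 + v x) K μ := (integrableOn_const hK).add hv
  refine Integrable.mono' h1 ?_ (ae_of_all _ fun x => ?_)
  · exact (Real.continuous_rpow_const hm₀.le).comp_aestronglyMeasurable hv.1
  · rw [Real.norm_of_nonneg (Real.rpow_nonneg (hv₀ x) _)]
    exact rpow_le_one_add hm₀.le hm₁ (hv₀ x)

/-- Jensen's inequality for the concave power `m`. -/
theorem setIntegral_rpow_le {α : Type*} [MeasurableSpace α] {μ : Measure α}
    {K : Set α} (hK : μ K ≠ ⊤) (hK₀ : μ K ≠ 0) {m : ℝ} (hm₀ : 0 < m) (hm₁ : m ≤ 1) {v : α → ℝ}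
    (hv₀ : ∀ x, 0 ≤ v x) (hv : IntegrableOn v K μ) :
    ∫ x in K, v x ^ m ∂μ ≤ μ.real K ^ (1 - m) * (∫ x in K, v x ∂μ) ^ m := by
  have : Fact (μ K < ⊤) := ⟨hK.lt_top⟩
  have : NeZero (μ.restrict K) := ⟨by rwa [Ne, Measure.restrict_eq_zero]⟩
  have hV : 0 < μ.real K := ENNReal.toReal_pos hK₀ hK
  have h := (Real.concaveOn_rpow hm₀.le hm₁).le_map_average (μ := μ.restrict K)
    ((Real.continuous_rpow_const hm₀.le).continuousOn) isClosed_Ici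
    (ae_of_all _ hv₀) hv (hv.rpow_of_le_one hK hm₀ hm₁ hv₀)
  rw [setAverage_eq, setAverage_eq, smul_eq_mul, smul_eq_mul,
    Real.mul_rpow (by positivity) (integral_nonneg hv₀), inv_mul_le_iff₀ hV] at h
  refine h.trans_eq ?_
  rw [Real.inv_rpow hV.le, Real.rpow_sub hV, Real.rpow_one]
  field_simp

/-- A continuous function which, at every `t ∈ (a, b]`, has arbitrarily small nearly nonpositive
left increments, does not increase. -/
theorem le_of_left_increments_le {f : ℝ → ℝ} {a b : ℝ} (hab : a ≤ b)
    (hf : ContinuousOn f (Icc a b))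
    (H : ∀ t ∈ Ioc a b, ∀ c > 0, ∃ᶠ h in 𝓝[>] (0 : ℝ), f t - f (t - h) ≤ c * h) :
    f b ≤ f a := by
  -- The reflection `x ↦ -f(-x)` turns left increments of `f` into right slopes, for which the
  -- comparison principle is stated.
  have hneg : ContinuousOn (fun x => -f (-x)) (Icc (-b) (-a)) :=
    (hf.comp continuous_neg.continuousOn fun x hx => ⟨by linarith [hx.2], by linarith [hx.1]⟩).neg
  have key : ∀ r > 0, f b - f a ≤ r * (b - a) := by
    intro r hr
    have := image_le_of_liminf_slope_right_lt_deriv_boundary' (f := fun x => -f (-x))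
      (f' := fun _ => 0) (B := fun x => -f b + r * (x + b)) (B' := fun _ => r) hneg ?_ (by simp)
      (by fun_prop) ?_ (fun _ _ _ => hr) (x := -a) ⟨by linarith, le_rfl⟩
    · simp only [neg_neg] at this
      nlinarith
    · intro x hx c hc
      have h1 := H (-x) ⟨by linarith [hx.2], by linarith [hx.1]⟩ (c / 2) (half_pos hc)
      have h2 : ∃ᶠ h in 𝓝[>] (0 : ℝ), slope (fun x => -f (-x)) x (x + h) < c := by
        refine (h1.and_eventually self_mem_nhdsWithin).mono ?_
        rintro h ⟨h3, h4⟩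
        have h4' : 0 < h := h4
        rw [slope_def_field, add_sub_cancel_left, div_lt_iff₀ h4', neg_add]
        have : -x + -h = -x - h := by ring
        rw [this]
        nlinarith
      have h5 : Tendsto (fun h => x + h) (𝓝[>] (0 : ℝ)) (𝓝[>] x) := by
        have : Tendsto (fun h => x + h) (𝓝[>] (0 : ℝ)) (𝓝[>] (x + 0)) := by
          refine tendsto_nhdsWithin_of_tendsto_nhds_of_eventually_within _ ?_ ?_
          · exact ((continuous_const.add continuous_id).tendsto 0).mono_left nhdsWithin_le_nhds
          · filter_upwards [self_mem_nhdsWithin] with h hh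
            have : (0 : ℝ) < h := hh
            simpa using this
        simpa using this
      exact h5.frequently h2
    · intro x _
      simpa using ((((hasDerivAt_id x).add_const b).const_mul r).const_add
        (-f b)).hasDerivWithinAt (s := Ici x)
  -- The denominator `b - a + 1` below stays positive when `a = b`.
  refine le_of_forall_pos_le_add fun e he => ?_
  have h1 := key (e / (b - a + 1)) (div_pos he (by linarith))
  have h2 : e / (b - a + 1) * (b - a) ≤ e := by
    rw [div_mul_eq_mul_div, div_le_iff₀ (by linarith)]
    nlinarith
  linarith

/-! ### Integrals of radial powers over small balls. -/

section Power

variable {n : ℕ}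

theorem integrable_indicator_norm_rpow (hn : 1 ≤ n) {s : ℝ} (hs : s < n) :
    Integrable ((Metric.closedBall (0 : EuclideanSpace ℝ (Fin n)) 1).indicator
      fun x => ‖x‖ ^ (-s)) := by
  rw [integrable_indicator_iff Metric.isClosed_closedBall.measurableSet]
  have : Nonempty (Fin n) := ⟨⟨0, hn⟩⟩
  have h : IntegrableOn (fun x : EuclideanSpace ℝ (Fin n) => ‖x‖ ^ (-s)) (Metric.ball 0 2) := by
    rw [integrableOn_fun_norm_addHaar volume (f := fun y => y ^ (-s))]
    have h1 : IntegrableOn (fun y : ℝ => y ^ ((n : ℝ) - 1 - s)) (Ioo 0 2) :=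
      (intervalIntegral.integrableOn_Ioo_rpow_iff (by norm_num)).2 (by linarith)
    refine h1.congr_fun (fun y hy => ?_) measurableSet_Ioo
    simp only [finrank_euclideanSpace, Fintype.card_fin, smul_eq_mul]
    rw [← Real.rpow_natCast, ← Real.rpow_add hy.1, Nat.cast_sub hn]
    congr 1
    push_cast
    ring
  exact h.mono_set (Metric.closedBall_subset_ball (by norm_num))

/-- The integral of `|x - p|⁻ˢ` over a ball of radius `ε`, for `s < n`. -/
theorem exists_setIntegral_norm_rpow_le (hn : 1 ≤ n) {s : ℝ} (hs : s < n) :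
    ∃ C : ℝ, 0 ≤ C ∧ ∀ (p : EuclideanSpace ℝ (Fin n)) (ε : ℝ), 0 < ε →
      IntegrableOn (fun x => ‖x - p‖ ^ (-s)) (Metric.closedBall p ε) ∧
      ∫ x in Metric.closedBall p ε, ‖x - p‖ ^ (-s) ≤ C * ε ^ ((n : ℝ) - s) := by
  set F := (Metric.closedBall (0 : EuclideanSpace ℝ (Fin n)) 1).indicator fun x => ‖x‖ ^ (-s)
    with hF
  have hFi : Integrable F := integrable_indicator_norm_rpow hn hs
  refine ⟨∫ x, F x, integral_nonneg fun x => indicator_nonneg (fun y _ => by positivity) x,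
    fun p ε hε => ?_⟩
  have h1 : (Metric.closedBall p ε).indicator (fun x => ‖x - p‖ ^ (-s)) =
      fun x => ε ^ (-s) * F (ε⁻¹ • (x - p)) := by
    ext x
    by_cases hx : x ∈ Metric.closedBall p ε
    · have hx' : ε⁻¹ • (x - p) ∈ Metric.closedBall (0 : EuclideanSpace ℝ (Fin n)) 1 := by
        rw [mem_closedBall_zero_iff, norm_smul, norm_inv, Real.norm_of_nonneg hε.le,
          inv_mul_le_iff₀ hε, mul_one]
        rwa [mem_closedBall_iff_norm] at hx
      rw [indicator_of_mem hx, hF, indicator_of_mem hx', norm_smul, norm_inv,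
        Real.norm_of_nonneg hε.le, Real.mul_rpow (by positivity) (norm_nonneg _), ← mul_assoc,
        ← Real.mul_rpow hε.le (by positivity), mul_inv_cancel₀ hε.ne', Real.one_rpow, one_mul]
    · have hx' : ε⁻¹ • (x - p) ∉ Metric.closedBall (0 : EuclideanSpace ℝ (Fin n)) 1 := by
        rw [mem_closedBall_zero_iff, norm_smul, norm_inv, Real.norm_of_nonneg hε.le,
          inv_mul_le_iff₀ hε, mul_one]
        rwa [mem_closedBall_iff_norm] at hx
      rw [indicator_of_notMem hx, hF, indicator_of_notMem hx', mul_zero]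
  have h2 : Integrable fun x => ε ^ (-s) * F (ε⁻¹ • (x - p)) :=
    ((hFi.comp_smul (inv_ne_zero hε.ne')).comp_sub_right p).const_mul _
  have h3 := Metric.isClosed_closedBall (x := p) (ε := ε) |>.measurableSet
  refine ⟨(integrable_indicator_iff h3).1 (h1 ▸ h2), ?_⟩
  rw [← integral_indicator h3, h1, integral_const_mul,
    integral_sub_right_eq_self (fun x => F (ε⁻¹ • x)) p,
    Measure.integral_comp_inv_smul_of_nonneg _ _ hε.le, finrank_euclideanSpace, Fintype.card_fin,
    smul_eq_mul, Real.rpow_sub hε, Real.rpow_neg hε.le, Real.rpow_natCast]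
  apply le_of_eq
  ring

end Power

/-! ### The Laplacian as a sum of directional second derivatives: chain rule, scaling, cutoffs. -/

section Laplacian

variable {E : Type*} [NormedAddCommGroup E] [InnerProductSpace ℝ E]

/-- The second derivative of `f` in the direction `v`. -/
noncomputable def dirDeriv₂ (v : E) (f : E → ℝ) (x : E) : ℝ :=
  fderiv ℝ (fun y => fderiv ℝ f y v) x v

theorem ContDiffAt.differentiableAt_fderiv {f : E → ℝ} {x : E} (hf : ContDiffAt ℝ 2 f x) :
    DifferentiableAt ℝ (fderiv ℝ f) x :=
  (hf.fderiv_right (m := 1) (by norm_num)).differentiableAt (by norm_num)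

theorem ContDiffAt.dirDeriv₂_eq {f : E → ℝ} {x : E} (hf : ContDiffAt ℝ 2 f x) (v : E) :
    dirDeriv₂ v f x = iteratedFDeriv ℝ 2 f x ![v, v] := by
  rw [iteratedFDeriv_two_apply, dirDeriv₂,
    fderiv_clm_apply hf.differentiableAt_fderiv (differentiableAt_const _)]
  simp

theorem ContDiffAt.eventually_two {f : E → ℝ} {x : E} (hf : ContDiffAt ℝ 2 f x) :
    ∀ᶠ y in 𝓝 x, ContDiffAt ℝ 2 f y :=
  hf.eventually (by norm_num)

theorem ContDiffAt.continuousAt_dirDeriv₂ {f : E → ℝ} {x : E} (hf : ContDiffAt ℝ 2 f x) (v : E) :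
    ContinuousAt (dirDeriv₂ v f) x := by
  have h1 : ContDiffAt ℝ 1 (fun y => fderiv ℝ f y v) x :=
    (hf.fderiv_right (m := 1) (by norm_num)).clm_apply contDiffAt_const
  have h2 : ContDiffAt ℝ 0 (fderiv ℝ fun y => fderiv ℝ f y v) x :=
    h1.fderiv_right (m := 0) (by norm_num)
  exact (h2.clm_apply contDiffAt_const).continuousAt

theorem dirDeriv₂_comp_smul_sub {f : E → ℝ} (hf : ContDiff ℝ 2 f) (v p : E) (c : ℝ) (x : E) :
    dirDeriv₂ v (fun y => f (c • (y - p))) x = c ^ 2 * dirDeriv₂ v f (c • (x - p)) := by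
  have hA : ∀ y, HasFDerivAt (fun y : E => c • (y - p)) (c • ContinuousLinearMap.id ℝ E) y :=
    fun y => ((hasFDerivAt_id y).sub_const p).const_smul c
  have h1 : (fun y => fderiv ℝ (fun y => f (c • (y - p))) y v) =
      fun y => c * (fderiv ℝ f (c • (y - p)) v) := by
    ext y
    have := ((hf.differentiable (by norm_num) (c • (y - p))).hasFDerivAt.comp y (hA y)).fderiv
    simp only [Function.comp_def] at this
    rw [this]
    simp
  have h2 : DifferentiableAt ℝ (fun y => fderiv ℝ f y v) (c • (x - p)) :=
    hf.contDiffAt.differentiableAt_fderiv.clm_apply (differentiableAt_const v)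
  have h3 := ((h2.hasFDerivAt.comp x (hA x)).const_mul c).fderiv
  simp only [Function.comp_def] at h3
  rw [dirDeriv₂, h1, h3, dirDeriv₂]
  simp
  ring

theorem ContDiffAt.dirDeriv₂_comp {J J' J'' : ℝ → ℝ} (hJ : ∀ y, HasDerivAt J (J' y) y)
    (hJ' : ∀ y, HasDerivAt J' (J'' y) y) {z : E → ℝ} {x : E} (hz : ContDiffAt ℝ 2 z x) (v : E) :
    dirDeriv₂ v (fun y => J (z y)) x =
      J' (z x) * dirDeriv₂ v z x + J'' (z x) * (fderiv ℝ z x v) ^ 2 := by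
  have h1 : (fun y => fderiv ℝ (fun y => J (z y)) y v) =ᶠ[𝓝 x]
      fun y => J' (z y) * fderiv ℝ z y v := by
    filter_upwards [hz.eventually_two] with y hy
    have := ((hJ (z y)).comp_hasFDerivAt y (hy.differentiableAt (by norm_num)).hasFDerivAt).fderiv
    simp only [Function.comp_def] at this
    rw [this]
    simp
  have h2 : DifferentiableAt ℝ (fun y => fderiv ℝ z y v) x :=
    hz.differentiableAt_fderiv.clm_apply (differentiableAt_const v)
  have h3 := (hJ' (z x)).comp_hasFDerivAt x (hz.differentiableAt (by norm_num)).hasFDerivAt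
  have h4 := (h3.mul h2.hasFDerivAt).fderiv
  rw [dirDeriv₂, h1.fderiv_eq]
  simp only [Function.comp_def] at h4
  erw [h4]
  simp [dirDeriv₂]
  ring

variable [FiniteDimensional ℝ E]

theorem ContDiffAt.laplacian_eq_sum {f : E → ℝ} {x : E} (hf : ContDiffAt ℝ 2 f x) :
    Laplacian.laplacian f x = ∑ i, dirDeriv₂ (stdOrthonormalBasis ℝ E i) f x := by
  rw [laplacian_eq_iteratedFDeriv_orthonormalBasis f (stdOrthonormalBasis ℝ E)]
  exact Finset.sum_congr rfl fun i _ => (hf.dirDeriv₂_eq _).symm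

theorem ContDiffAt.continuousAt_laplacian {f : E → ℝ} {x : E} (hf : ContDiffAt ℝ 2 f x) :
    ContinuousAt (Laplacian.laplacian f) x := by
  have h : (fun y => ∑ i, dirDeriv₂ (stdOrthonormalBasis ℝ E i) f y) =ᶠ[𝓝 x]
      Laplacian.laplacian f := by
    filter_upwards [hf.eventually_two] with y hy using hy.laplacian_eq_sum.symm
  refine ContinuousAt.congr ?_ h
  exact tendsto_finsetSum _ fun i _ => hf.continuousAt_dirDeriv₂ _

theorem ContDiff.continuous_laplacian {f : E → ℝ} (hf : ContDiff ℝ 2 f) :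
    Continuous (Laplacian.laplacian f) :=
  continuous_iff_continuousAt.2 fun _ => hf.contDiffAt.continuousAt_laplacian

theorem laplacian_eq_zero_of_notMem_tsupport {f : E → ℝ} {x : E} (hx : x ∉ tsupport f) :
    Laplacian.laplacian f x = 0 := by
  have h : f =ᶠ[𝓝 x] fun _ => 0 := notMem_tsupport_iff_eventuallyEq.1 hx
  rw [(laplacian_congr_nhds h).eq_of_nhds]
  simp

theorem tsupport_laplacian_subset (f : E → ℝ) :
    tsupport (Laplacian.laplacian f : E → ℝ) ⊆ tsupport f :=
  closure_minimal (fun x hx => by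
    by_contra h
    exact hx (laplacian_eq_zero_of_notMem_tsupport h)) (isClosed_tsupport f)

theorem HasCompactSupport.laplacian {f : E → ℝ} (hf : HasCompactSupport f) :
    HasCompactSupport (Laplacian.laplacian f : E → ℝ) :=
  hf.of_isClosed_subset (isClosed_tsupport _) (tsupport_laplacian_subset f)

theorem laplacian_comp_smul_sub {f : E → ℝ} (hf : ContDiff ℝ 2 f) (p : E) (c : ℝ) (x : E) :
    Laplacian.laplacian (fun y => f (c • (y - p))) x =
      c ^ 2 * Laplacian.laplacian f (c • (x - p)) := by
  have h : ContDiff ℝ 2 fun y => f (c • (y - p)) :=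
    hf.comp (contDiff_const.smul (contDiff_id.sub contDiff_const))
  rw [h.contDiffAt.laplacian_eq_sum, hf.contDiffAt.laplacian_eq_sum, Finset.mul_sum]
  exact Finset.sum_congr rfl fun i _ => dirDeriv₂_comp_smul_sub hf _ p c x

theorem ContDiffAt.laplacian_comp {J J' J'' : ℝ → ℝ} (hJ : ∀ y, HasDerivAt J (J' y) y)
    (hJ' : ∀ y, HasDerivAt J' (J'' y) y) (hJ₂ : ContDiff ℝ 2 J)
    {z : E → ℝ} {x : E} (hz : ContDiffAt ℝ 2 z x) :
    Laplacian.laplacian (fun y => J (z y)) x = J' (z x) * Laplacian.laplacian z x +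
      J'' (z x) * ∑ i, (fderiv ℝ z x (stdOrthonormalBasis ℝ E i)) ^ 2 := by
  have h : ContDiffAt ℝ 2 (fun y => J (z y)) x := hJ₂.contDiffAt.comp x hz
  rw [h.laplacian_eq_sum, hz.laplacian_eq_sum, Finset.mul_sum, Finset.mul_sum,
    ← Finset.sum_add_distrib]
  exact Finset.sum_congr rfl fun i _ => hz.dirDeriv₂_comp hJ hJ' _

/-- A high power of a cutoff function has a Laplacian bounded by its `m`-th power. -/
theorem exists_abs_laplacian_pow_le {ρ : E → ℝ} (hρ : ContDiff ℝ 2 ρ) (hc : HasCompactSupport ρ)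
    (h₀ : ∀ x, 0 ≤ ρ x) (h₁ : ∀ x, ρ x ≤ 1) {m : ℝ} {q : ℕ} (hq : m * q ≤ q - 2)
    (hq3 : 3 ≤ q) :
    ∃ C : ℝ, 0 ≤ C ∧ ∀ x, |Laplacian.laplacian (fun y => ρ y ^ q) x| ≤ C * (ρ x ^ q) ^ m := by
  obtain ⟨A, hA⟩ := hc.laplacian.exists_bound_of_continuous hρ.continuous_laplacian
  have hg : ∀ i, ∃ B, ∀ x, ‖fderiv ℝ ρ x (stdOrthonormalBasis ℝ E i)‖ ≤ B := fun i =>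
    (hc.fderiv_apply (𝕜 := ℝ) (stdOrthonormalBasis ℝ E i)).exists_bound_of_continuous
      ((hρ.continuous_fderiv (by norm_num)).clm_apply continuous_const)
  choose B hB using hg
  have hA0 : 0 ≤ A := (norm_nonneg _).trans (hA 0)
  refine ⟨q * A + q * (q - 1 : ℕ) * ∑ i, B i ^ 2, by positivity, fun x => ?_⟩
  have h2 : ContDiffAt ℝ 2 ρ x := hρ.contDiffAt
  rw [h2.laplacian_comp (J := fun y => y ^ q) (J' := fun y => q * y ^ (q - 1))
    (J'' := fun y => q * ((q - 1 : ℕ) * y ^ (q - 1 - 1))) (fun y => hasDerivAt_pow q y)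
    (fun y => (hasDerivAt_pow (q - 1) y).const_mul _) (contDiff_id.pow q)]
  -- `Δ(ρ^q)` contains the powers `q-1` and `q-2` of `ρ`. Both are at most `ρ^(qm)`, since `0 ≤ ρ ≤
  -- 1` and `mq ≤ q - 2`. Where `ρ = 0`, `q ≥ 3` makes these powers vanish.
  have hpow : ∀ k : ℕ, q - 2 ≤ k → ρ x ^ k ≤ (ρ x ^ q) ^ m := by
    intro k hk
    rcases (h₀ x).eq_or_lt with h | h
    · rw [← h]
      rw [zero_pow (by omega)]
      positivity
    · rw [← Real.rpow_natCast, ← Real.rpow_natCast, ← Real.rpow_mul h.le]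
      refine Real.rpow_le_rpow_of_exponent_ge h (h₁ x) ?_
      have : ((q - 2 : ℕ) : ℝ) ≤ k := by exact_mod_cast hk
      rw [Nat.cast_sub (by omega)] at this
      push_cast at this
      linarith
  have hgrad : ∑ i, (fderiv ℝ ρ x (stdOrthonormalBasis ℝ E i)) ^ 2 ≤ ∑ i, B i ^ 2 :=
    Finset.sum_le_sum fun i _ => by
      rw [← sq_abs]
      exact pow_le_pow_left₀ (abs_nonneg _) (hB i x) 2
  have hP : 0 ≤ (ρ x ^ q) ^ m := Real.rpow_nonneg (pow_nonneg (h₀ x) _) _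
  calc _ ≤ |q * ρ x ^ (q - 1) * Laplacian.laplacian ρ x| +
        |q * ((q - 1 : ℕ) * ρ x ^ (q - 1 - 1)) *
          ∑ i, (fderiv ℝ ρ x (stdOrthonormalBasis ℝ E i)) ^ 2| := abs_add_le _ _
    _ = q * ρ x ^ (q - 1) * |Laplacian.laplacian ρ x| + q * ((q - 1 : ℕ) * ρ x ^ (q - 1 - 1)) *
          ∑ i, (fderiv ℝ ρ x (stdOrthonormalBasis ℝ E i)) ^ 2 := by
      have h5 : 0 ≤ (q : ℝ) * ρ x ^ (q - 1) := mul_nonneg (by positivity) (pow_nonneg (h₀ x) _)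
      have h6 : 0 ≤ (q : ℝ) * ((q - 1 : ℕ) * ρ x ^ (q - 1 - 1)) :=
        mul_nonneg (by positivity) (mul_nonneg (by positivity) (pow_nonneg (h₀ x) _))
      rw [abs_mul, abs_of_nonneg h5, abs_of_nonneg
        (mul_nonneg h6 (Finset.sum_nonneg fun i _ => sq_nonneg _))]
    _ ≤ q * (ρ x ^ q) ^ m * A + q * ((q - 1 : ℕ) * (ρ x ^ q) ^ m) * ∑ i, B i ^ 2 := by
      have h3 := hpow (q - 1) (by omega)
      have h4 := hpow (q - 1 - 1) (by omega)
      have h5 := pow_nonneg (h₀ x) (q - 1)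
      have h6 := pow_nonneg (h₀ x) (q - 1 - 1)
      have h7 : |Laplacian.laplacian ρ x| ≤ A := hA x
      gcongr
    _ = _ := by ring

end Laplacian

/-! ### Integration by parts against test functions supported where the other factor is smooth. -/

theorem continuous_mul_of_continuousAt {X : Type*} [TopologicalSpace X] {F φ : X → ℝ}
    (hφ : Continuous φ) (hF : ∀ x ∈ tsupport φ, ContinuousAt F x) :
    Continuous fun x => F x * φ x := by
  refine continuous_iff_continuousAt.2 fun x => ?_
  by_cases hx : x ∈ tsupport φ
  · exact (hF x hx).mul hφ.continuousAt
  · have h : (fun y => F y * φ y) =ᶠ[𝓝 x] fun _ => 0 := by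
      filter_upwards [notMem_tsupport_iff_eventuallyEq.1 hx] with y hy
      simp [hy]
    exact continuousAt_const.congr h.symm

section IntegrationByParts

variable {E : Type*} [NormedAddCommGroup E] [InnerProductSpace ℝ E] [FiniteDimensional ℝ E]
  [MeasurableSpace E] [BorelSpace E]

theorem integrable_mul_of_continuousAt {F φ : E → ℝ} (hφ : Continuous φ)
    (hc : HasCompactSupport φ) (hF : ∀ x ∈ tsupport φ, ContinuousAt F x) :
    Integrable fun x => F x * φ x :=
  (continuous_mul_of_continuousAt hφ hF).integrable_of_hasCompactSupport hc.mul_left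

theorem integral_dirDeriv₂_mul {F φ : E → ℝ} (hφ : ContDiff ℝ 2 φ) (hc : HasCompactSupport φ)
    (hF : ∀ x ∈ tsupport φ, ContDiffAt ℝ 2 F x) (v : E) :
    ∫ x, dirDeriv₂ v F x * φ x = ∫ x, F x * dirDeriv₂ v φ x := by
  have hφ' : Continuous fun x => fderiv ℝ φ x v :=
    (hφ.continuous_fderiv (by norm_num)).clm_apply continuous_const
  have hc' : HasCompactSupport fun x => fderiv ℝ φ x v := hc.fderiv_apply (𝕜 := ℝ) v
  have hsub : tsupport (fun x => fderiv ℝ φ x v) ⊆ tsupport φ :=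
    tsupport_fderiv_apply_subset ℝ v
  have hφ'' : Continuous (dirDeriv₂ v φ) :=
    continuous_iff_continuousAt.2 fun x => hφ.contDiffAt.continuousAt_dirDeriv₂ v
  have hsub' : tsupport (dirDeriv₂ v φ) ⊆ tsupport φ :=
    (tsupport_fderiv_apply_subset ℝ v).trans hsub
  have hc'' : HasCompactSupport (dirDeriv₂ v φ) :=
    hc.of_isClosed_subset (isClosed_tsupport _) hsub'
  have hF1 : ∀ x ∈ tsupport φ, DifferentiableAt ℝ (fun y => fderiv ℝ F y v) x := fun x hx =>
    (hF x hx).differentiableAt_fderiv.clm_apply (differentiableAt_const v)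
  have h1 := integral_mul_fderiv_eq_neg_fderiv_mul_of_integrable (μ := (volume : Measure E))
    (f := fun y => fderiv ℝ F y v) (g := φ) (v := v)
    (integrable_mul_of_continuousAt hφ.continuous hc
      fun x hx => (hF x hx).continuousAt_dirDeriv₂ v)
    (integrable_mul_of_continuousAt hφ' hc' fun x hx => (hF1 x (hsub hx)).continuousAt)
    (integrable_mul_of_continuousAt hφ.continuous hc fun x hx => (hF1 x hx).continuousAt)
    hF1 (fun x _ => hφ.differentiable (by norm_num) x)
  have h2 := integral_mul_fderiv_eq_neg_fderiv_mul_of_integrable (μ := (volume : Measure E))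
    (f := F) (g := fun y => fderiv ℝ φ y v) (v := v)
    (integrable_mul_of_continuousAt hφ' hc' fun x hx => (hF1 x (hsub hx)).continuousAt)
    (integrable_mul_of_continuousAt hφ'' hc'' fun x hx => (hF x (hsub' hx)).continuousAt)
    (integrable_mul_of_continuousAt hφ' hc' fun x hx => (hF x (hsub hx)).continuousAt)
    (fun x hx => (hF x (hsub hx)).differentiableAt (by norm_num))
    (fun x _ => hφ.contDiffAt.differentiableAt_fderiv.clm_apply (differentiableAt_const v))
  simp only [dirDeriv₂]
  rw [h2, h1, neg_neg]

theorem integral_laplacian_mul {F φ : E → ℝ} (hφ : ContDiff ℝ 2 φ) (hc : HasCompactSupport φ)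
    (hF : ∀ x ∈ tsupport φ, ContDiffAt ℝ 2 F x) :
    ∫ x, Laplacian.laplacian F x * φ x = ∫ x, F x * Laplacian.laplacian φ x := by
  have h1 : ∀ x, Laplacian.laplacian F x * φ x =
      ∑ i, dirDeriv₂ (stdOrthonormalBasis ℝ E i) F x * φ x := by
    intro x
    by_cases hx : x ∈ tsupport φ
    · rw [(hF x hx).laplacian_eq_sum, Finset.sum_mul]
    · simp [image_eq_zero_of_notMem_tsupport hx]
  have h2 : ∀ x, F x * Laplacian.laplacian φ x =
      ∑ i, F x * dirDeriv₂ (stdOrthonormalBasis ℝ E i) φ x := by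
    intro x
    rw [hφ.contDiffAt.laplacian_eq_sum, Finset.mul_sum]
  have hsub : ∀ v, tsupport (dirDeriv₂ v φ) ⊆ tsupport φ := fun v =>
    (tsupport_fderiv_apply_subset ℝ v).trans (tsupport_fderiv_apply_subset ℝ v)
  simp only [h1, h2]
  rw [integral_finsetSum, integral_finsetSum]
  · exact Finset.sum_congr rfl fun i _ => integral_dirDeriv₂_mul hφ hc hF _
  · exact fun i _ => integrable_mul_of_continuousAt
      (continuous_iff_continuousAt.2 fun x => hφ.contDiffAt.continuousAt_dirDeriv₂ _)
      (hc.of_isClosed_subset (isClosed_tsupport _) (hsub _))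
      fun x hx => (hF x (hsub _ hx)).continuousAt
  · exact fun i _ => integrable_mul_of_continuousAt hφ.continuous hc
      fun x hx => (hF x hx).continuousAt_dirDeriv₂ _

end IntegrationByParts

/-! ### Smoothing of the absolute value. -/

section SmoothAbs

/-- A smooth approximation of the absolute value. -/
noncomputable def smoothAbs (d y : ℝ) : ℝ := √(y ^ 2 + d ^ 2)

theorem smoothAbs_pos {d : ℝ} (hd : 0 < d) (y : ℝ) : 0 < smoothAbs d y :=
  Real.sqrt_pos.2 (by positivity)

theorem sq_smoothAbs (d y : ℝ) : smoothAbs d y ^ 2 = y ^ 2 + d ^ 2 :=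
  Real.sq_sqrt (by positivity)

theorem contDiff_smoothAbs {d : ℝ} (hd : 0 < d) : ContDiff ℝ 2 (smoothAbs d) :=
  ContDiff.sqrt (by fun_prop) fun y => by positivity

theorem hasDerivAt_smoothAbs {d : ℝ} (hd : 0 < d) (y : ℝ) :
    HasDerivAt (smoothAbs d) (y / smoothAbs d y) y := by
  have h1 : HasDerivAt (fun y : ℝ => y ^ 2 + d ^ 2) (2 * y) y := by
    simpa using (hasDerivAt_pow 2 y).add_const (d ^ 2)
  have h := h1.sqrt (by positivity)
  rw [mul_div_mul_left _ _ two_ne_zero] at h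
  exact h

theorem hasDerivAt_div_smoothAbs {d : ℝ} (hd : 0 < d) (y : ℝ) :
    HasDerivAt (fun y => y / smoothAbs d y) (d ^ 2 / smoothAbs d y ^ 3) y := by
  have hp := smoothAbs_pos hd y
  have h := (hasDerivAt_id y).div (hasDerivAt_smoothAbs hd y) hp.ne'
  refine h.congr_deriv ?_
  simp only [id]
  have h2 := sq_smoothAbs d y
  field_simp
  linarith

theorem abs_div_smoothAbs_le {d : ℝ} (hd : 0 < d) (y : ℝ) : |y / smoothAbs d y| ≤ 1 := by
  rw [abs_div, abs_of_pos (smoothAbs_pos hd y), div_le_one (smoothAbs_pos hd y)]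
  exact Real.abs_le_sqrt (by nlinarith [sq_nonneg d])

theorem smoothAbs_le {d : ℝ} (hd : 0 ≤ d) (y : ℝ) : smoothAbs d y ≤ |y| + d := by
  refine Real.sqrt_le_iff.2 ⟨by positivity, ?_⟩
  nlinarith [sq_abs y, mul_nonneg (abs_nonneg y) hd]

theorem tendsto_smoothAbs (y : ℝ) {d : ℕ → ℝ} (hd : Tendsto d atTop (𝓝 0)) :
    Tendsto (fun k => smoothAbs (d k) y) atTop (𝓝 |y|) := by
  have h : Continuous fun d : ℝ => smoothAbs d y := by unfold smoothAbs; fun_prop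
  have := (h.tendsto 0).comp hd
  simpa [smoothAbs, Real.sqrt_sq_eq_abs, Function.comp_def] using this

theorem tendsto_div_smoothAbs (y : ℝ) {d : ℕ → ℝ} (hd : Tendsto d atTop (𝓝 0)) :
    Tendsto (fun k => y / smoothAbs (d k) y) atTop (𝓝 (SignType.sign y : ℝ)) := by
  rcases eq_or_ne y 0 with rfl | hy
  · simp
  · have h := (tendsto_const_nhds (x := y)).div (tendsto_smoothAbs y hd) (abs_ne_zero.2 hy)
    rwa [show y / |y| = (SignType.sign y : ℝ) by
      rw [div_eq_iff (abs_ne_zero.2 hy), sign_mul_abs]] at h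

theorem abs_coe_sign_le (y : ℝ) : |(SignType.sign y : ℝ)| ≤ 1 := by
  rcases lt_trichotomy y 0 with h | h | h <;> simp [h]

theorem measurable_coe_sign : Measurable fun y : ℝ => (SignType.sign y : ℝ) := by
  have h := tendsto_one_div_add_atTop_nhds_zero_nat (𝕜 := ℝ)
  refine measurable_of_tendsto_metrizable (f := fun (k : ℕ) (y : ℝ) =>
    y / smoothAbs (1 / ((k : ℝ) + 1)) y) (fun k => ?_)
    (tendsto_pi_nhds.2 fun y => tendsto_div_smoothAbs y h)
  unfold smoothAbs
  fun_prop

/-- `|f|` need not be differentiable at the zeros of `f`, so the fundamental theorem of calculus is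
applied to `smoothAbs d ∘ f`, and `d → 0` by dominated convergence. -/
theorem integral_sign_mul_deriv {f f' : ℝ → ℝ} {s t : ℝ}
    (hf : ∀ x ∈ uIcc s t, HasDerivAt f (f' x) x) (hf' : ContinuousOn f' (uIcc s t)) :
    ∫ x in s..t, (SignType.sign (f x) : ℝ) * f' x = |f t| - |f s| := by
  set d : ℕ → ℝ := fun k => 1 / ((k : ℝ) + 1)
  have hd : Tendsto d atTop (𝓝 0) := tendsto_one_div_add_atTop_nhds_zero_nat
  have hd0 : ∀ k, 0 < d k := fun k => by positivity
  have hfc : ContinuousOn f (uIcc s t) := fun x hx => (hf x hx).continuousAt.continuousWithinAt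
  have hdc : ∀ k, Continuous fun y => y / smoothAbs (d k) y := fun k =>
    continuous_iff_continuousAt.2 fun y => (hasDerivAt_div_smoothAbs (hd0 k) y).continuousAt
  have hc : ∀ k, ContinuousOn (fun x => f x / smoothAbs (d k) (f x) * f' x) (uIcc s t) :=
    fun k => ((hdc k).comp_continuousOn hfc).mul hf'
  have h1 : ∀ k, ∫ x in s..t, f x / smoothAbs (d k) (f x) * f' x =
      smoothAbs (d k) (f t) - smoothAbs (d k) (f s) := fun k =>
    intervalIntegral.integral_eq_sub_of_hasDerivAt (f := fun x => smoothAbs (d k) (f x))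
      (fun x hx => (hasDerivAt_smoothAbs (hd0 k) (f x)).comp x (hf x hx)) (hc k).intervalIntegrable
  have h2 : Tendsto (fun k => ∫ x in s..t, f x / smoothAbs (d k) (f x) * f' x) atTop
      (𝓝 (∫ x in s..t, (SignType.sign (f x) : ℝ) * f' x)) := by
    refine intervalIntegral.tendsto_integral_filter_of_dominated_convergence (fun x => |f' x|)
      (Eventually.of_forall fun k => ?_) (Eventually.of_forall fun k => ?_) ?_ ?_
    · exact ((hc k).mono uIoc_subset_uIcc).aestronglyMeasurable measurableSet_uIoc
    · refine ae_of_all _ fun x _ => ?_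
      rw [Real.norm_eq_abs, abs_mul]
      exact mul_le_of_le_one_left (abs_nonneg _) (abs_div_smoothAbs_le (hd0 k) _)
    · exact (hf'.abs).intervalIntegrable
    · exact ae_of_all _ fun x _ => (tendsto_div_smoothAbs _ hd).mul_const _
  simp only [h1] at h2
  exact tendsto_nhds_unique h2 ((tendsto_smoothAbs _ hd).sub (tendsto_smoothAbs _ hd))

end SmoothAbs

/-! ### Kato's inequality and the time derivative of a weighted `L¹` norm. -/

section Kato

variable {E : Type*} [NormedAddCommGroup E] [InnerProductSpace ℝ E] [FiniteDimensional ℝ E]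
  [MeasurableSpace E] [BorelSpace E]

/-- Kato's inequality tested with a nonnegative function. -/
theorem integral_sign_mul_laplacian_le {z φ : E → ℝ} (hφ : ContDiff ℝ 2 φ)
    (hc : HasCompactSupport φ) (hφ₀ : ∀ x, 0 ≤ φ x)
    (hz : ∀ x ∈ tsupport φ, ContDiffAt ℝ 2 z x) :
    ∫ x, (SignType.sign (z x) : ℝ) * Laplacian.laplacian z x * φ x ≤
      ∫ x, |z x| * Laplacian.laplacian φ x := by
  set d : ℕ → ℝ := fun k => 1 / ((k : ℝ) + 1)
  have hd : Tendsto d atTop (𝓝 0) := tendsto_one_div_add_atTop_nhds_zero_nat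
  have hd0 : ∀ k, 0 < d k := fun k => by positivity
  have hd1 : ∀ k, d k ≤ 1 := fun k => by
    simp only [d]
    rw [div_le_one (by positivity)]
    linarith [(Nat.cast_nonneg k : (0 : ℝ) ≤ k)]
  have hdc : ∀ k, Continuous fun y => y / smoothAbs (d k) y := fun k =>
    continuous_iff_continuousAt.2 fun y => (hasDerivAt_div_smoothAbs (hd0 k) y).continuousAt
  have hint1 : ∀ k, Integrable fun x =>
      z x / smoothAbs (d k) (z x) * Laplacian.laplacian z x * φ x := fun k =>
    integrable_mul_of_continuousAt hφ.continuous hc fun x hx =>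
      (ContinuousAt.comp (g := fun y => y / smoothAbs (d k) y) (hdc k).continuousAt
        (hz x hx).continuousAt).mul (hz x hx).continuousAt_laplacian
  have hJz : ∀ k, ∀ x ∈ tsupport φ, ContDiffAt ℝ 2 (fun y => smoothAbs (d k) (z y)) x :=
    fun k x hx => (contDiff_smoothAbs (hd0 k)).contDiffAt.comp x (hz x hx)
  have hle : ∀ k, ∫ x, z x / smoothAbs (d k) (z x) * Laplacian.laplacian z x * φ x ≤
      ∫ x, smoothAbs (d k) (z x) * Laplacian.laplacian φ x := by
    intro k
    rw [← integral_laplacian_mul hφ hc (hJz k)]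
    refine integral_mono (hint1 k) (integrable_mul_of_continuousAt hφ.continuous hc fun x hx =>
      (hJz k x hx).continuousAt_laplacian) fun x => ?_
    by_cases hx : x ∈ tsupport φ
    · simp only
      rw [(hz x hx).laplacian_comp (hasDerivAt_smoothAbs (hd0 k))
        (hasDerivAt_div_smoothAbs (hd0 k)) (contDiff_smoothAbs (hd0 k))]
      -- The discarded term is `J''(z) |∇z|² φ` with `J = smoothAbs`, nonnegative by convexity of
      -- `J`.
      refine mul_le_mul_of_nonneg_right (le_add_of_nonneg_right ?_) (hφ₀ x)
      have := smoothAbs_pos (hd0 k) (z x)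
      positivity
    · simp [image_eq_zero_of_notMem_tsupport hx]
  have hl : Tendsto (fun k => ∫ x, z x / smoothAbs (d k) (z x) * Laplacian.laplacian z x * φ x)
      atTop (𝓝 (∫ x, (SignType.sign (z x) : ℝ) * Laplacian.laplacian z x * φ x)) := by
    refine tendsto_integral_of_dominated_convergence
      (fun x => |Laplacian.laplacian z x * φ x|) (fun k => (hint1 k).1) ?_ ?_ ?_
    · exact (integrable_mul_of_continuousAt hφ.continuous hc fun x hx =>
        (hz x hx).continuousAt_laplacian).abs
    · refine fun k => ae_of_all _ fun x => ?_
      rw [Real.norm_eq_abs, mul_assoc, abs_mul]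
      exact mul_le_of_le_one_left (abs_nonneg _) (abs_div_smoothAbs_le (hd0 k) _)
    · exact ae_of_all _ fun x => ((tendsto_div_smoothAbs _ hd).mul_const _).mul_const _
  have hr : Tendsto (fun k => ∫ x, smoothAbs (d k) (z x) * Laplacian.laplacian φ x)
      atTop (𝓝 (∫ x, |z x| * Laplacian.laplacian φ x)) := by
    refine tendsto_integral_of_dominated_convergence
      (fun x => |(|z x| + 1) * Laplacian.laplacian φ x|) (fun k => ?_) ?_ ?_ ?_
    · exact (integrable_mul_of_continuousAt hφ.continuous_laplacian hc.laplacian fun x hx =>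
        (hJz k x (tsupport_laplacian_subset φ hx)).continuousAt).1
    · exact (integrable_mul_of_continuousAt hφ.continuous_laplacian hc.laplacian fun x hx =>
        ((hz x (tsupport_laplacian_subset φ hx)).continuousAt.abs.add continuousAt_const)).abs
    · refine fun k => ae_of_all _ fun x => ?_
      rw [Real.norm_eq_abs, abs_mul, abs_mul, abs_of_pos (smoothAbs_pos (hd0 k) _),
        abs_of_nonneg (by positivity : 0 ≤ |z x| + 1)]
      gcongr
      exact (smoothAbs_le (hd0 k).le _).trans (by linarith [hd1 k])
    · exact ae_of_all _ fun x => (tendsto_smoothAbs _ hd).mul_const _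
  exact le_of_tendsto_of_tendsto' hl hr hle

/-- After Fubini this is `integral_sign_mul_deriv` at each fixed `x`. The integrand is only
measurable because of the sign, but it is bounded on the compact set `tsupport φ × [s, t]`. -/
theorem intervalIntegrable_and_integral_sign_mul {φ : E → ℝ} (hφ : Continuous φ)
    (hc : HasCompactSupport φ) {s t : ℝ} (hst : s ≤ t) {w w' : E → ℝ → ℝ}
    (hw : ∀ x ∈ tsupport φ, ∀ τ ∈ Icc s t, HasDerivAt (w x) (w' x τ) τ)
    (hwc : ContinuousOn (fun p : E × ℝ => w p.1 p.2) (tsupport φ ×ˢ Icc s t))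
    (hwc' : ContinuousOn (fun p : E × ℝ => w' p.1 p.2) (tsupport φ ×ˢ Icc s t)) :
    IntervalIntegrable (fun τ => ∫ x, (SignType.sign (w x τ) : ℝ) * w' x τ * φ x) volume s t ∧
    ∫ τ in s..t, ∫ x, (SignType.sign (w x τ) : ℝ) * w' x τ * φ x =
      (∫ x, |w x t| * φ x) - ∫ x, |w x s| * φ x := by
  have hK : IsCompact (tsupport φ ×ˢ Icc s t) := IsCompact.prod hc isCompact_Icc
  have hKm : MeasurableSet (tsupport φ ×ˢ Icc s t) := hK.isClosed.measurableSet
  set f : ℝ → E → ℝ := fun τ x => (SignType.sign (w x τ) : ℝ) * w' x τ * φ x with hf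
  have hint : IntegrableOn (fun p : E × ℝ => f p.2 p.1) (tsupport φ ×ˢ Icc s t)
      (volume.prod volume) := by
    obtain ⟨C, hC⟩ := hK.exists_bound_of_continuousOn
      (hwc'.mul (hφ.comp continuous_fst).continuousOn)
    have hfin : (volume.prod volume : Measure (E × ℝ)) (tsupport φ ×ˢ Icc s t) ≠ ⊤ :=
      hK.measure_lt_top.ne
    refine Integrable.mono' (integrableOn_const (C := C) hfin) ?_ ?_
    · have h1 : AEMeasurable (fun p : E × ℝ => (SignType.sign (w p.1 p.2) : ℝ))
          ((volume.prod volume).restrict (tsupport φ ×ˢ Icc s t)) :=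
        measurable_coe_sign.comp_aemeasurable (hwc.aemeasurable hKm)
      exact ((h1.mul (hwc'.aemeasurable hKm)).mul
        (hφ.comp continuous_fst).measurable.aemeasurable).aestronglyMeasurable
    · refine (ae_restrict_iff' hKm).2 (ae_of_all _ fun p hp => ?_)
      simp only [hf]
      rw [Real.norm_eq_abs, mul_assoc, abs_mul]
      exact (mul_le_of_le_one_left (abs_nonneg _) (abs_coe_sign_le _)).trans (hC p hp)
  have hint2 : Integrable (Function.uncurry f) ((volume.restrict (uIoc s t)).prod volume) := by
    have h1 : IntegrableOn (Function.uncurry f) (Icc s t ×ˢ tsupport φ)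
        (volume.prod volume) := by
      have := hint.swap
      simpa [Function.uncurry_def, Function.comp_def] using this
    have h2 : IntegrableOn (Function.uncurry f) (Icc s t ×ˢ univ) (volume.prod volume) := by
      refine h1.of_forall_sdiff_eq_zero (measurableSet_Icc.prod MeasurableSet.univ) ?_
      rintro ⟨τ, x⟩ ⟨hp1, hp2⟩
      have : x ∉ tsupport φ := fun h => hp2 ⟨hp1.1, h⟩
      simp [hf, image_eq_zero_of_notMem_tsupport this]
    have h3 := h2.mono_set (prod_mono (uIoc_of_le hst ▸ Ioc_subset_Icc_self) subset_rfl :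
      uIoc s t ×ˢ univ ⊆ Icc s t ×ˢ (univ : Set E))
    rwa [IntegrableOn, ← Measure.prod_restrict, Measure.restrict_univ] at h3
  refine ⟨intervalIntegrable_iff.2 hint2.integral_prod_left, ?_⟩
  rw [intervalIntegral_integral_swap hint2, ← integral_sub]
  · refine integral_congr_ae (ae_of_all _ fun x => ?_)
    by_cases hx : x ∈ tsupport φ
    · simp only [hf]
      rw [intervalIntegral.integral_mul_const, integral_sign_mul_deriv (f := w x) (f' := w' x),
        sub_mul]
      · rw [uIcc_of_le hst]
        exact hw x hx
      · rw [uIcc_of_le hst]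
        exact hwc'.comp (f := fun τ => (x, τ)) (by fun_prop) fun τ hτ => ⟨hx, hτ⟩
    · simp [hf, image_eq_zero_of_notMem_tsupport hx]
  all_goals
    refine (integrableOn_iff_integrable_of_support_subset (s := tsupport φ) fun x hx => ?_).1 ?_
    · exact subset_tsupport φ fun h => hx (by simp [h])
    · refine ContinuousOn.integrableOn_compact hc (ContinuousOn.mul (ContinuousOn.abs ?_)
        hφ.continuousOn)
      exact hwc.comp (f := fun x => (x, _)) (by fun_prop) fun x hx => ⟨hx, by simp [hst]⟩

end Kato

/-! ### Weighted `L¹` norms as continuous functions of time. -/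

section L1Loc

variable {n : ℕ} {u w : EuclideanSpace ℝ (Fin n) → ℝ → ℝ} {φ : EuclideanSpace ℝ (Fin n) → ℝ}

theorem IsContinuousInL1Loc.sub (hu : IsContinuousInL1Loc u) (hw : IsContinuousInL1Loc w) :
    IsContinuousInL1Loc fun x t => u x t - w x t := by
  refine ⟨fun t ht => (hu.locallyIntegrable t ht).sub (hw.locallyIntegrable t ht),
    fun K hK t ht => ?_⟩
  have h := (hu.tendsto K hK t ht).add (hw.tendsto K hK t ht)
  rw [add_zero] at h
  refine squeeze_zero' (Eventually.of_forall fun s => integral_nonneg fun x => abs_nonneg _) ?_ h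
  filter_upwards [self_mem_nhdsWithin] with s hs
  have hu' := ((hu.locallyIntegrable s hs).integrableOn_isCompact hK).sub
    ((hu.locallyIntegrable t ht).integrableOn_isCompact hK)
  have hw' := ((hw.locallyIntegrable s hs).integrableOn_isCompact hK).sub
    ((hw.locallyIntegrable t ht).integrableOn_isCompact hK)
  refine le_trans ?_ (integral_add hu'.abs hw'.abs).le
  refine integral_mono (hu'.sub hw' |>.abs.congr (ae_of_all _ fun x => ?_))
    (hu'.abs.add hw'.abs) fun x => ?_
  · simp only [Pi.sub_apply]
    congr 1
    ring
  · have h3 : u x s - w x s - (u x t - w x t) = (u x s - u x t) - (w x s - w x t) := by ring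
    simp only [Pi.sub_apply]
    rw [h3]
    exact abs_sub _ _

theorem IsContinuousInL1Loc.integrable_abs_mul (hw : IsContinuousInL1Loc w) (hφ : Continuous φ)
    (hc : HasCompactSupport φ) {t : ℝ} (ht : 0 ≤ t) : Integrable fun x => |w x t| * φ x := by
  refine (integrableOn_iff_integrable_of_support_subset (s := tsupport φ) fun x hx => ?_).1 ?_
  · exact subset_tsupport φ fun h => hx (by simp [h])
  · have h : IntegrableOn (fun x => |w x t|) (tsupport φ) :=
      ((hw.locallyIntegrable t ht).integrableOn_isCompact hc).abs
    exact h.mul_continuousOn hφ.continuousOn hc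

/-- Continuity in `L¹_loc` suffices, so the support of the weight may contain the singular point,
and continuity extends down to `t = 0`, where the two solutions agree. -/
theorem IsContinuousInL1Loc.continuousOn_integral (hw : IsContinuousInL1Loc w)
    (hφ : Continuous φ) (hc : HasCompactSupport φ) :
    ContinuousOn (fun t => ∫ x, |w x t| * φ x) (Ici 0) := by
  intro t ht
  obtain ⟨B, hB⟩ := hc.exists_bound_of_continuous hφ
  have hB0 : 0 ≤ B := (norm_nonneg _).trans (hB 0)
  rw [ContinuousWithinAt, tendsto_iff_dist_tendsto_zero]
  have h := (hw.tendsto (tsupport φ) hc t ht).const_mul B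
  rw [mul_zero] at h
  refine squeeze_zero' (Eventually.of_forall fun s => dist_nonneg) ?_ h
  filter_upwards [self_mem_nhdsWithin] with s hs
  rw [Real.dist_eq, ← integral_sub (hw.integrable_abs_mul hφ hc hs)
    (hw.integrable_abs_mul hφ hc ht), ← integral_const_mul]
  refine (abs_integral_le_integral_abs).trans ?_
  have hi : IntegrableOn (fun x => B * |w x s - w x t|) (tsupport φ) :=
    (((hw.locallyIntegrable s hs).integrableOn_isCompact hc).sub
      ((hw.locallyIntegrable t ht).integrableOn_isCompact hc)).abs.const_mul B
  rw [← integral_indicator (isClosed_tsupport φ).measurableSet]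
  refine integral_mono ((hw.integrable_abs_mul hφ hc hs).sub
    (hw.integrable_abs_mul hφ hc ht)).abs
    (hi.integrable_indicator (isClosed_tsupport φ).measurableSet) fun x => ?_
  by_cases hx : x ∈ tsupport φ
  · simp only [indicator_of_mem hx]
    rw [← sub_mul, abs_mul, mul_comm]
    exact mul_le_mul (hB x) (abs_abs_sub_abs_le_abs_sub _ _) (abs_nonneg _) hB0
  · simp [indicator_of_notMem hx, image_eq_zero_of_notMem_tsupport hx]

end L1Loc

/-! ### The Herrero–Pierre estimate and the cutoff functions. -/

section HerreroPierre

variable {n : ℕ}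

/-- If `|θ| ≤ C φ^m`, then `v^m |θ|` is dominated by `C (vφ)^m`, and Jensen's inequality on a ball
of radius comparable to `ε` gives the factor `ε^(n(1-m))`. With `θ` a Laplacian, a flux is thus
bounded by the power `m` of a mass. The domination of `f` is required only almost everywhere, so
values on the curve do not matter. -/
theorem exists_integral_rpow_mul_le {m : ℝ} (hm₀ : 0 < m) (hm₁ : m ≤ 1)
    {θ φ : EuclideanSpace ℝ (Fin n) → ℝ} (hc : HasCompactSupport φ)
    (hφ₀ : ∀ x, 0 ≤ φ x) {C : ℝ} (hC : 0 ≤ C) (hθ : ∀ x, |θ x| ≤ C * φ x ^ m) :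
    ∃ C' : ℝ, 0 ≤ C' ∧ ∀ (p : EuclideanSpace ℝ (Fin n)) (ε : ℝ), 0 < ε →
      ∀ v : EuclideanSpace ℝ (Fin n) → ℝ, (∀ x, 0 ≤ v x) →
      Integrable (fun x => v x * φ (ε⁻¹ • (x - p))) →
      ∀ f : EuclideanSpace ℝ (Fin n) → ℝ, (∀ x, 0 ≤ f x) →
      (∀ᵐ x, f x ≤ v x ^ m * |θ (ε⁻¹ • (x - p))|) →
      ∫ x, f x ≤ C' * ε ^ ((n : ℝ) * (1 - m)) * (∫ x, v x * φ (ε⁻¹ • (x - p))) ^ m := by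
  obtain ⟨r, hr0, hr⟩ := (Metric.isBounded_iff_subset_closedBall 0).1 hc.isBounded |>.imp
    fun r hr => (⟨le_max_right r 1, hr.trans (Metric.closedBall_subset_closedBall
      (le_max_left r 1))⟩ : 1 ≤ max r 1 ∧ tsupport φ ⊆ Metric.closedBall 0 (max r 1))
  set R := max r 1
  have hR : 0 < R := by linarith
  set b := volume.real (Metric.ball (0 : EuclideanSpace ℝ (Fin n)) 1)
  have hb : 0 ≤ b := measureReal_nonneg
  refine ⟨C * (R ^ n * b) ^ (1 - m), by positivity, fun p ε hε v hv hvi f hf hfv => ?_⟩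
  set K := Metric.closedBall p (ε * R)
  have hKm : MeasurableSet K := Metric.isClosed_closedBall.measurableSet
  have hKt : volume K ≠ ⊤ := measure_closedBall_lt_top.ne
  have hK0 : volume K ≠ 0 := (Metric.measure_closedBall_pos _ _ (by positivity)).ne'
  have hout : ∀ x, x ∉ K → φ (ε⁻¹ • (x - p)) = 0 := by
    intro x hx
    by_contra h
    have h1 := hr (subset_tsupport φ h)
    rw [mem_closedBall_zero_iff, norm_smul, norm_inv, Real.norm_of_nonneg hε.le,
      inv_mul_le_iff₀ hε] at h1
    exact hx (mem_closedBall_iff_norm.2 h1)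
  have hvφ : ∀ x, 0 ≤ v x * φ (ε⁻¹ • (x - p)) := fun x => mul_nonneg (hv x) (hφ₀ _)
  have hpow := (hvi.integrableOn (s := K)).rpow_of_le_one hKt hm₀ hm₁ hvφ
  calc ∫ x, f x ≤ ∫ x, K.indicator (fun x => C * (v x * φ (ε⁻¹ • (x - p))) ^ m) x := by
        refine integral_mono_of_nonneg (ae_of_all _ hf)
          ((integrable_indicator_iff hKm).2 (hpow.const_mul C)) ?_
        filter_upwards [hfv] with x hx
        refine hx.trans ?_
        have h1 := hθ (ε⁻¹ • (x - p))
        by_cases hxK : x ∈ K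
        · rw [indicator_of_mem hxK, Real.mul_rpow (hv x) (hφ₀ _)]
          calc v x ^ m * |θ (ε⁻¹ • (x - p))| ≤ v x ^ m * (C * φ (ε⁻¹ • (x - p)) ^ m) :=
                mul_le_mul_of_nonneg_left h1 (Real.rpow_nonneg (hv x) _)
            _ = _ := by ring
        · rw [indicator_of_notMem hxK]
          rw [hout x hxK, Real.zero_rpow hm₀.ne', mul_zero] at h1
          rw [le_antisymm h1 (abs_nonneg _), mul_zero]
    _ = C * ∫ x in K, (v x * φ (ε⁻¹ • (x - p))) ^ m := by
        rw [integral_indicator hKm, integral_const_mul]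
    _ ≤ C * (volume.real K ^ (1 - m) * (∫ x in K, v x * φ (ε⁻¹ • (x - p))) ^ m) :=
        mul_le_mul_of_nonneg_left (setIntegral_rpow_le hKt hK0 hm₀ hm₁ hvφ hvi.integrableOn) hC
    _ ≤ C * (volume.real K ^ (1 - m) * (∫ x, v x * φ (ε⁻¹ • (x - p))) ^ m) := by
        have := setIntegral_le_integral (s := K) hvi (ae_of_all _ hvφ)
        have h0 : 0 ≤ ∫ x in K, v x * φ (ε⁻¹ • (x - p)) := integral_nonneg hvφ
        gcongr
    _ = _ := by
        have h1 : volume.real K = ε ^ n * (R ^ n * b) := by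
          rw [Measure.addHaar_real_closedBall _ _ (by positivity), finrank_euclideanSpace,
            Fintype.card_fin, mul_pow, mul_assoc]
        rw [h1, Real.mul_rpow (by positivity) (by positivity), ← Real.rpow_natCast ε,
          ← Real.rpow_mul hε.le]
        ring

theorem exists_bump (n : ℕ) : ∃ f : EuclideanSpace ℝ (Fin n) → ℝ, ContDiff ℝ 2 f ∧
    HasCompactSupport f ∧ (∀ x, 0 ≤ f x) ∧ (∀ x, f x ≤ 1) ∧ (∀ x, ‖x‖ ≤ 1 → f x = 1) ∧
    (∀ x, 2 ≤ ‖x‖ → f x = 0) := by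
  let f : ContDiffBump (0 : EuclideanSpace ℝ (Fin n)) := ⟨1, 2, by norm_num, by norm_num⟩
  exact ⟨f, f.contDiff, f.hasCompactSupport, fun x => f.nonneg, fun x => f.le_one,
    fun x hx => f.one_of_mem_closedBall (mem_closedBall_zero_iff.2 hx),
    fun x hx => f.zero_of_le_dist (by simpa using hx)⟩

/-- Cutoff functions: `ψ` equals one on the unit ball, `η` equals one on the unit ball and vanishes
off the ball of radius two, and `ζ` lives on an annulus and controls the Laplacian of `η`. -/
theorem exists_cutoffs (n : ℕ) {m : ℝ} (hm₁ : m < 1) :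
    ∃ (ψ η ζ : EuclideanSpace ℝ (Fin n) → ℝ) (C : ℝ), 0 ≤ C ∧
      (ContDiff ℝ 2 ψ ∧ HasCompactSupport ψ ∧ (∀ x, 0 ≤ ψ x) ∧ (∀ x, ‖x‖ ≤ 1 → ψ x = 1) ∧
        ∀ x, |Laplacian.laplacian ψ x| ≤ C * ψ x ^ m) ∧
      (ContDiff ℝ 2 η ∧ HasCompactSupport η ∧ (∀ x, 0 ≤ η x) ∧ (∀ x, η x ≤ 1) ∧
        (∀ x, ‖x‖ ≤ 1 → η x = 1) ∧ (∀ x, 2 ≤ ‖x‖ → η x = 0) ∧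
        (∀ x, |Laplacian.laplacian η x| ≤ C * ζ x ^ m) ∧
        (∀ x, |Laplacian.laplacian η x| ≤ C)) ∧
      (ContDiff ℝ 2 ζ ∧ HasCompactSupport ζ ∧ (∀ x, 0 ≤ ζ x) ∧ (∀ x, ζ x ≤ 1) ∧
        (∀ x, ‖x‖ ≤ 1 / 2 → ζ x = 0) ∧ (∀ x, 4 ≤ ‖x‖ → ζ x = 0) ∧
        ∀ x, |Laplacian.laplacian ζ x| ≤ C * ζ x ^ m) := by
  obtain ⟨f, hf, hfc, hf0, hfle, hf1, hf2⟩ := exists_bump n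
  -- The choice `q ≥ 2 / (1 - m)` is exactly `mq ≤ q - 2`.
  obtain ⟨q, hq⟩ := exists_nat_ge (max 3 (2 / (1 - m)))
  have hq3 : 3 ≤ q := by exact_mod_cast (le_max_left _ _).trans hq
  have hqm : m * q ≤ q - 2 := by
    have := (le_max_right _ _).trans hq
    rw [div_le_iff₀ (by linarith)] at this
    linarith
  -- An annular cutoff: `g = 1` on `1 ≤ ‖x‖ ≤ 2`, the region outside which `Δf` vanishes, and `g =
  -- 0` for `‖x‖ ≤ 1/2` and for `‖x‖ ≥ 4`.
  set g : EuclideanSpace ℝ (Fin n) → ℝ := fun x => f ((1 / 2 : ℝ) • x) - f ((2 : ℝ) • x) with hg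
  have hgd : ContDiff ℝ 2 g :=
    ContDiff.sub (f := fun x => f ((1 / 2 : ℝ) • x)) (g := fun x => f ((2 : ℝ) • x))
      (hf.comp (g := f) (f := fun x => (1 / 2 : ℝ) • x) (by fun_prop))
      (hf.comp (g := f) (f := fun x => (2 : ℝ) • x) (by fun_prop))
  have hg4 : ∀ x, 4 ≤ ‖x‖ → g x = 0 := by
    intro x hx
    simp only [hg]
    rw [hf2 _ (by rw [norm_smul]; norm_num; linarith),
      hf2 _ (by rw [norm_smul]; norm_num; linarith), sub_zero]
  have hghalf : ∀ x, ‖x‖ ≤ 1 / 2 → g x = 0 := by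
    intro x hx
    simp only [hg]
    rw [hf1 _ (by rw [norm_smul]; norm_num; linarith),
      hf1 _ (by rw [norm_smul]; norm_num; linarith), sub_self]
  have hg1 : ∀ x, 1 ≤ ‖x‖ → ‖x‖ ≤ 2 → g x = 1 := by
    intro x hx hx'
    simp only [hg]
    rw [hf1 _ (by rw [norm_smul]; norm_num; linarith),
      hf2 _ (by rw [norm_smul]; norm_num; linarith), sub_zero]
  have hgle : ∀ x, g x ≤ 1 := fun x => by
    have := hfle ((1 / 2 : ℝ) • x)
    have := hf0 ((2 : ℝ) • x)
    simp only [hg]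
    linarith
  have hg0 : ∀ x, 0 ≤ g x := fun x => by
    rcases le_total ‖x‖ 2 with h | h
    · have h1 : f ((1 / 2 : ℝ) • x) = 1 := hf1 _ (by rw [norm_smul]; norm_num; linarith)
      have := hfle ((2 : ℝ) • x)
      simp only [hg, h1]
      linarith
    · have h1 : f ((2 : ℝ) • x) = 0 := hf2 _ (by rw [norm_smul]; norm_num; linarith)
      have := hf0 ((1 / 2 : ℝ) • x)
      simp only [hg, h1]
      linarith
  have hgc : HasCompactSupport g := by
    refine HasCompactSupport.intro (isCompact_closedBall 0 4) fun x hx => hg4 x ?_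
    rw [mem_closedBall_zero_iff, not_le] at hx
    exact hx.le
  have hpowc : ∀ {h : EuclideanSpace ℝ (Fin n) → ℝ}, HasCompactSupport h →
      HasCompactSupport fun x => h x ^ q := fun hh =>
    hh.comp_left (g := fun y : ℝ => y ^ q) (zero_pow (by omega))
  obtain ⟨C₁, hC₁, h₁⟩ := exists_abs_laplacian_pow_le hf hfc hf0
    hfle hqm hq3
  obtain ⟨C₂, hC₂, h₂⟩ := exists_abs_laplacian_pow_le hgd hgc hg0 hgle hqm hq3
  obtain ⟨C₃, h₃⟩ := hfc.laplacian.exists_bound_of_continuous hf.continuous_laplacian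
  have hC₃ : 0 ≤ C₃ := (norm_nonneg _).trans (h₃ 0)
  have hlapf : ∀ x, ‖x‖ < 1 ∨ 2 < ‖x‖ → Laplacian.laplacian f x = 0 := by
    rintro x (hx | hx)
    · have : f =ᶠ[𝓝 x] fun _ => 1 := by
        filter_upwards [(isOpen_lt continuous_norm continuous_const).mem_nhds hx] with y hy
          using hf1 y (le_of_lt hy)
      rw [(laplacian_congr_nhds this).eq_of_nhds]
      simp
    · have : f =ᶠ[𝓝 x] fun _ => 0 := by
        filter_upwards [(isOpen_lt continuous_const continuous_norm).mem_nhds hx] with y hy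
          using hf2 y (le_of_lt hy)
      rw [(laplacian_congr_nhds this).eq_of_nhds]
      simp
  -- Only `ψ` and `ζ` must control their own Laplacians, hence the power `q`. For `η = f` a bounded
  -- Laplacian is enough, because `ζ = 1` wherever it is nonzero.
  refine ⟨fun x => f x ^ q, f, fun x => g x ^ q, C₁ + C₂ + C₃, by positivity,
    ⟨hf.pow q, hpowc hfc, fun x => pow_nonneg (hf0 x) q, fun x hx => ?_, fun x => ?_⟩,
    ⟨hf, hfc, hf0, hfle, hf1, hf2, fun x => ?_, fun x => ?_⟩,
    ⟨hgd.pow q, hpowc hgc, fun x => pow_nonneg (hg0 x) q,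
      fun x => pow_le_one₀ (hg0 x) (hgle x), fun x hx => ?_, fun x hx => ?_, fun x => ?_⟩⟩
  · simp [hf1 x hx]
  · refine (h₁ x).trans ?_
    have : 0 ≤ (f x ^ q) ^ m := Real.rpow_nonneg (pow_nonneg (hf0 x) q) m
    gcongr
    linarith
  · by_cases hx : ‖x‖ < 1 ∨ 2 < ‖x‖
    · rw [hlapf x hx, abs_zero]
      have : 0 ≤ (g x ^ q) ^ m := Real.rpow_nonneg (pow_nonneg (hg0 x) q) m
      positivity
    · push Not at hx
      simp only
      rw [hg1 x hx.1 hx.2, one_pow, Real.one_rpow, mul_one]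
      have : |Laplacian.laplacian f x| ≤ C₃ := h₃ x
      linarith
  · have : |Laplacian.laplacian f x| ≤ C₃ := h₃ x
    linarith
  · simp only [hghalf x hx]
    exact zero_pow (by omega)
  · simp only [hg4 x hx]
    exact zero_pow (by omega)
  · refine (h₂ x).trans ?_
    have : 0 ≤ (g x ^ q) ^ m := Real.rpow_nonneg (pow_nonneg (hg0 x) q) m
    gcongr
    linarith

end HerreroPierre

/-! ### The equation tested with functions supported off the singular curve. -/

section Solutions

variable {n : ℕ} {m lam : ℝ} {ξ : ℝ → EuclideanSpace ℝ (Fin n)} {k : ℝ → ℝ}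
  {u₀ : EuclideanSpace ℝ (Fin n) → ℝ} {u u₁ u₂ : EuclideanSpace ℝ (Fin n) → ℝ → ℝ}
  {φ : EuclideanSpace ℝ (Fin n) → ℝ}

theorem IsSingularSolution.hasDerivAt (h : IsSingularSolution m lam ξ k u₀ u) {t : ℝ} (ht : 0 < t)
    {x : EuclideanSpace ℝ (Fin n)} (hx : x ≠ ξ t) : HasDerivAt (u x) (deriv (u x) t) t :=
  (h.regular.time (x, t) ⟨hx, ht⟩).hasDerivAt

theorem IsSingularSolution.contDiffAt_rpow (h : IsSingularSolution m lam ξ k u₀ u) {t : ℝ}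
    (ht : 0 < t) {x : EuclideanSpace ℝ (Fin n)} (hx : x ≠ ξ t) :
    ContDiffAt ℝ 2 (fun y => u y t ^ m) x :=
  ContDiffAt.rpow_const_of_ne (h.regular.space (x, t) ⟨hx, ht⟩) (h.pos t ht.le x hx).ne'

/-- Kato's inequality produces the sign of `u₁^m - u₂^m`, whereas the time derivative of `|u₁ - u₂|`
needs the sign of `u₁ - u₂`. -/
theorem sign_rpow_sub_rpow (hm₀ : 0 < m) {a b : ℝ} (ha : 0 < a) (hb : 0 < b) :
    SignType.sign (a ^ m - b ^ m) = SignType.sign (a - b) := by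
  rcases lt_trichotomy a b with h | h | h
  · rw [sign_neg (sub_neg.2 h), sign_neg (sub_neg.2 (Real.rpow_lt_rpow ha.le h hm₀))]
  · simp [h]
  · rw [sign_pos (sub_pos.2 h), sign_pos (sub_pos.2 (Real.rpow_lt_rpow hb.le h hm₀))]

/-- The `L¹` contraction inequality for two solutions, tested off the singular curve. -/
theorem IsSingularSolution.integral_abs_sub_le (hm₀ : 0 < m)
    (h₁ : IsSingularSolution m lam ξ k u₀ u₁) (h₂ : IsSingularSolution m lam ξ k u₀ u₂)
    (hφ : ContDiff ℝ 2 φ) (hc : HasCompactSupport φ) (hφ₀ : ∀ x, 0 ≤ φ x)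
    {s t : ℝ} (hs : 0 < s) (hst : s ≤ t) (hξ : ∀ τ ∈ Icc s t, ξ τ ∉ tsupport φ)
    {g : ℝ → ℝ} (hg : IntervalIntegrable g volume s t)
    (hle : ∀ τ ∈ Icc s t, ∫ x, |u₁ x τ ^ m - u₂ x τ ^ m| * Laplacian.laplacian φ x ≤ g τ) :
    ∫ x, |u₁ x t - u₂ x t| * φ x ≤ (∫ x, |u₁ x s - u₂ x s| * φ x) + ∫ τ in s..t, g τ := by
  have hne : ∀ x ∈ tsupport φ, ∀ τ ∈ Icc s t, x ≠ ξ τ := fun x hx τ hτ h => hξ τ hτ (h ▸ hx)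
  have hsub : tsupport φ ×ˢ Icc s t ⊆ {p | p.1 ≠ ξ p.2 ∧ 0 < p.2} := fun p hp =>
    ⟨hne p.1 hp.1 p.2 hp.2, hs.trans_le hp.2.1⟩
  obtain ⟨hi, he⟩ := intervalIntegrable_and_integral_sign_mul hφ.continuous hc hst
    (w := fun x τ => u₁ x τ - u₂ x τ) (w' := fun x τ => deriv (u₁ x) τ - deriv (u₂ x) τ)
    (fun x hx τ hτ => (h₁.hasDerivAt (hs.trans_le hτ.1) (hne x hx τ hτ)).sub
      (h₂.hasDerivAt (hs.trans_le hτ.1) (hne x hx τ hτ)))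
    ((h₁.regular.continuousOn.sub h₂.regular.continuousOn).mono hsub)
    ((h₁.regular.continuousOn_deriv.sub h₂.regular.continuousOn_deriv).mono hsub)
  have hmono := intervalIntegral.integral_mono_on hst hi hg fun τ hτ => by
    refine le_trans (le_of_eq ?_) ((integral_sign_mul_laplacian_le
      (z := fun x => u₁ x τ ^ m - u₂ x τ ^ m) hφ hc hφ₀ fun x hx => ?_).trans (hle τ hτ))
    · refine integral_congr_ae (ae_of_all _ fun x => ?_)
      by_cases hx : x ∈ tsupport φ
      · have hx' := hne x hx τ hτ
        have hτ0 := hs.trans_le hτ.1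
        have hL : Laplacian.laplacian (fun x => u₁ x τ ^ m - u₂ x τ ^ m) x =
            deriv (u₁ x) τ - deriv (u₂ x) τ := by
          rw [h₁.equation τ hτ0 x hx', h₂.equation τ hτ0 x hx']
          exact (h₁.contDiffAt_rpow hτ0 hx').laplacian_sub (h₂.contDiffAt_rpow hτ0 hx')
        simp only
        rw [hL, sign_rpow_sub_rpow hm₀ (h₁.pos τ hτ0.le x hx') (h₂.pos τ hτ0.le x hx')]
      · simp [image_eq_zero_of_notMem_tsupport hx]
    · exact (h₁.contDiffAt_rpow (hs.trans_le hτ.1) (hne x hx τ hτ)).sub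
        (h₂.contDiffAt_rpow (hs.trans_le hτ.1) (hne x hx τ hτ))
  rw [he] at hmono
  linarith

/-- Backward propagation of mass for one solution, tested off the singular curve. -/
theorem IsSingularSolution.integral_abs_le (h : IsSingularSolution m lam ξ k u₀ u)
    (hφ : ContDiff ℝ 2 φ) (hc : HasCompactSupport φ)
    {s t : ℝ} (hs : 0 < s) (hst : s ≤ t) (hξ : ∀ τ ∈ Icc s t, ξ τ ∉ tsupport φ)
    {g : ℝ → ℝ} (hg : IntervalIntegrable g volume s t)
    (hle : ∀ τ ∈ Icc s t, ∫ x, |u x τ ^ m| * |Laplacian.laplacian φ x| ≤ g τ) :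
    ∫ x, |u x s| * φ x ≤ (∫ x, |u x t| * φ x) + ∫ τ in s..t, g τ := by
  have hne : ∀ x ∈ tsupport φ, ∀ τ ∈ Icc s t, x ≠ ξ τ := fun x hx τ hτ h => hξ τ hτ (h ▸ hx)
  have hsub : tsupport φ ×ˢ Icc s t ⊆ {p | p.1 ≠ ξ p.2 ∧ 0 < p.2} := fun p hp =>
    ⟨hne p.1 hp.1 p.2 hp.2, hs.trans_le hp.2.1⟩
  obtain ⟨hi, he⟩ := intervalIntegrable_and_integral_sign_mul hφ.continuous hc hst
    (w := u) (w' := fun x τ => deriv (u x) τ)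
    (fun x hx τ hτ => h.hasDerivAt (hs.trans_le hτ.1) (hne x hx τ hτ))
    (h.regular.continuousOn.mono hsub) (h.regular.continuousOn_deriv.mono hsub)
  have hmono := intervalIntegral.integral_mono_on hst hi.neg hg fun τ hτ => by
    have hτ0 := hs.trans_le hτ.1
    have hC : ∀ x ∈ tsupport φ, ContDiffAt ℝ 2 (fun y => u y τ ^ m) x := fun x hx =>
      h.contDiffAt_rpow hτ0 (hne x hx τ hτ)
    have heq : ∫ x, (SignType.sign (u x τ) : ℝ) * deriv (u x) τ * φ x =
        ∫ x, u x τ ^ m * Laplacian.laplacian φ x := by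
      rw [← integral_laplacian_mul hφ hc hC]
      refine integral_congr_ae (ae_of_all _ fun x => ?_)
      by_cases hx : x ∈ tsupport φ
      · have hx' := hne x hx τ hτ
        simp only
        rw [sign_pos (h.pos τ hτ0.le x hx'), h.equation τ hτ0 x hx']
        simp
      · simp [image_eq_zero_of_notMem_tsupport hx]
    refine le_trans ?_ (hle τ hτ)
    rw [Pi.neg_apply, heq]
    refine (neg_le_abs _).trans (abs_integral_le_integral_abs.trans_eq ?_)
    simp only [abs_mul]
  simp only [Pi.neg_apply] at hmono
  rw [intervalIntegral.integral_neg, he] at hmono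
  linarith

end Solutions

/-! ### Cutoffs transplanted to balls of radius `ε`. -/

section Rescale

variable {n : ℕ}

/-- The function `f` transplanted to the ball of radius `ε` around `p`. -/
noncomputable def rescale (f : EuclideanSpace ℝ (Fin n) → ℝ) (p : EuclideanSpace ℝ (Fin n))
    (ε : ℝ) (x : EuclideanSpace ℝ (Fin n)) : ℝ := f (ε⁻¹ • (x - p))

variable {f : EuclideanSpace ℝ (Fin n) → ℝ} {p x : EuclideanSpace ℝ (Fin n)} {ε : ℝ}

theorem contDiff_rescale (hf : ContDiff ℝ 2 f) (p : EuclideanSpace ℝ (Fin n)) (ε : ℝ) :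
    ContDiff ℝ 2 (rescale f p ε) :=
  hf.comp (g := f) (f := fun x => ε⁻¹ • (x - p)) (by fun_prop)

theorem laplacian_rescale (hf : ContDiff ℝ 2 f) (p : EuclideanSpace ℝ (Fin n)) (ε : ℝ)
    (x : EuclideanSpace ℝ (Fin n)) :
    Laplacian.laplacian (rescale f p ε) x = (ε⁻¹) ^ 2 * Laplacian.laplacian f (ε⁻¹ • (x - p)) :=
  laplacian_comp_smul_sub hf p ε⁻¹ x

theorem norm_inv_smul_sub (hε : 0 < ε) : ‖ε⁻¹ • (x - p)‖ = ‖x - p‖ / ε := by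
  rw [norm_smul, norm_inv, Real.norm_of_nonneg hε.le]
  field_simp

theorem hasCompactSupport_rescale (hf : HasCompactSupport f) (p : EuclideanSpace ℝ (Fin n))
    (hε : 0 < ε) : HasCompactSupport (rescale f p ε) := by
  obtain ⟨r, hr⟩ := (Metric.isBounded_iff_subset_closedBall 0).1 hf.isBounded
  refine HasCompactSupport.intro (isCompact_closedBall p (r * ε)) fun x hx => ?_
  by_contra h
  have h1 := hr (subset_tsupport f h)
  rw [mem_closedBall_zero_iff, norm_inv_smul_sub hε, div_le_iff₀ hε] at h1
  exact hx (mem_closedBall_iff_norm.2 h1)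

theorem rescale_eq_one (hf : ∀ x, ‖x‖ ≤ 1 → f x = 1) (hε : 0 < ε) (hx : ‖x - p‖ ≤ ε) :
    rescale f p ε x = 1 :=
  hf _ (by rw [norm_inv_smul_sub hε, div_le_one hε]; exact hx)

theorem rescale_eq_zero {c : ℝ} (hf : ∀ x, c ≤ ‖x‖ → f x = 0) (hε : 0 < ε)
    (hx : c * ε ≤ ‖x - p‖) : rescale f p ε x = 0 :=
  hf _ (by rw [norm_inv_smul_sub hε, le_div_iff₀ hε]; exact hx)

theorem rescale_eq_zero' {c : ℝ} (hf : ∀ x, ‖x‖ ≤ c → f x = 0) (hε : 0 < ε)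
    (hx : ‖x - p‖ ≤ c * ε) : rescale f p ε x = 0 :=
  hf _ (by rw [norm_inv_smul_sub hε, div_le_iff₀ hε]; exact hx)

theorem notMem_tsupport_of_forall_ball {φ : EuclideanSpace ℝ (Fin n) → ℝ} {r : ℝ}
    {q : EuclideanSpace ℝ (Fin n)} (h : ∀ x, ‖x - p‖ < r → φ x = 0) (hq : ‖q - p‖ < r) :
    q ∉ tsupport φ := by
  rw [notMem_tsupport_iff_eventuallyEq]
  filter_upwards [Metric.isOpen_ball.mem_nhds (mem_ball_iff_norm.2 hq)] with y hy
    using h y (mem_ball_iff_norm.1 hy)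

theorem laplacian_eq_zero_of_forall_ball {φ : EuclideanSpace ℝ (Fin n) → ℝ} {r c : ℝ}
    (h : ∀ x, ‖x - p‖ < r → φ x = c) (x : EuclideanSpace ℝ (Fin n)) (hx : ‖x - p‖ < r) :
    Laplacian.laplacian φ x = 0 := by
  have h' : φ =ᶠ[𝓝 x] fun _ => c := by
    filter_upwards [Metric.isOpen_ball.mem_nhds (mem_ball_iff_norm.2 hx)] with y hy
      using h y (mem_ball_iff_norm.1 hy)
  rw [(laplacian_congr_nhds h').eq_of_nhds]
  simp

theorem setIntegral_closedBall_const_le {g : EuclideanSpace ℝ (Fin n) → ℝ} {r B : ℝ}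
    (hr : 0 ≤ r) (hg₀ : ∀ x, 0 ≤ g x) (hg : ∀ᵐ x, g x ≤ B)
    (hout : ∀ x, r < ‖x - p‖ → g x = 0) :
    ∫ x, g x ≤ B * (r ^ (n : ℝ) *
      volume.real (Metric.ball (0 : EuclideanSpace ℝ (Fin n)) 1)) := by
  have hm := Metric.isClosed_closedBall (x := p) (ε := r) |>.measurableSet
  have hfin : volume (Metric.closedBall p r) ≠ ⊤ := measure_closedBall_lt_top.ne
  calc ∫ x, g x ≤ ∫ x, (Metric.closedBall p r).indicator (fun _ => B) x := by
        refine integral_mono_of_nonneg (ae_of_all _ hg₀)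
          ((integrable_indicator_iff hm).2 (integrableOn_const hfin)) ?_
        filter_upwards [hg] with x hx
        by_cases hxb : x ∈ Metric.closedBall p r
        · rwa [indicator_of_mem hxb]
        · rw [indicator_of_notMem hxb, hout x]
          rwa [mem_closedBall_iff_norm, not_le] at hxb
    _ = _ := by
        rw [integral_indicator hm, setIntegral_const, Measure.addHaar_real_closedBall _ _ hr,
          finrank_euclideanSpace, Fintype.card_fin, smul_eq_mul, Real.rpow_natCast, mul_comm]

end Rescale

theorem ae_ne_point {n : ℕ} (hn : 1 ≤ n) (p : EuclideanSpace ℝ (Fin n)) :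
    ∀ᵐ x : EuclideanSpace ℝ (Fin n), x ≠ p := by
  have : Nonempty (Fin n) := ⟨⟨0, hn⟩⟩
  exact compl_mem_ae_iff.2 (measure_singleton p)

/-! ### Consequences of the singular asymptotics at a fixed time. -/

section LocalEstimates

variable {n : ℕ} {m lam : ℝ} {p : EuclideanSpace ℝ (Fin n)}

theorem eventually_nhdsNE_iff_norm {P : EuclideanSpace ℝ (Fin n) → Prop} :
    (∀ᶠ x in 𝓝[≠] p, P x) ↔ ∃ r > 0, ∀ x, x ≠ p → ‖x - p‖ < r → P x := by
  rw [eventually_nhdsWithin_iff, Metric.eventually_nhds_iff]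
  simp only [dist_eq_norm]
  exact ⟨fun ⟨r, hr, h⟩ => ⟨r, hr, fun x hx hxr => h hxr hx⟩,
    fun ⟨r, hr, h⟩ => ⟨r, hr, fun x hxr hx => h x hx hxr⟩⟩

/-- The error `O(‖x - p‖^(-lam))` is of lower order and is absorbed into one extra unit of the
leading coefficient. Only the radius `r` depends on the profile. The constant `κ^m + 1` depends on
the bound for the strength, which later makes `C₁`, `C₂`, `C₃` independent of time. -/
theorem HasSingularAsymptotics.exists_rpow_le {a κ : ℝ} {w : EuclideanSpace ℝ (Fin n) → ℝ}
    (h : HasSingularAsymptotics m a lam p w) (hm₀ : 0 < m) (hlam : lam < (n : ℝ) - 2)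
    (ha : 0 ≤ a) (haκ : a ≤ κ) :
    ∃ r > 0, ∀ x, x ≠ p → ‖x - p‖ < r → w x ^ m ≤ (κ ^ m + 1) * ‖x - p‖ ^ (2 - (n : ℝ)) := by
  obtain ⟨c, hc0, hc⟩ := h.exists_pos
  have ht : Tendsto (fun x : EuclideanSpace ℝ (Fin n) => c * ‖x - p‖ ^ ((n : ℝ) - 2 - lam))
      (𝓝[≠] p) (𝓝 0) := by
    have hcont : Continuous fun x : EuclideanSpace ℝ (Fin n) =>
        c * ‖x - p‖ ^ ((n : ℝ) - 2 - lam) :=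
      continuous_const.mul ((continuous_id.sub continuous_const).norm.rpow_const
        fun _ => Or.inr (by linarith))
    have := (hcont.tendsto p).mono_left (nhdsWithin_le_nhds (s := {p}ᶜ))
    simpa [Real.zero_rpow (by linarith : (n : ℝ) - 2 - lam ≠ 0)] using this
  rw [← eventually_nhdsNE_iff_norm]
  filter_upwards [hc.bound, ht.eventually (gt_mem_nhds one_pos), self_mem_nhdsWithin]
    with x hx h1 hxp
  have hr : 0 < ‖x - p‖ := norm_pos_iff.2 (sub_ne_zero.2 hxp)
  rw [Real.norm_eq_abs, Real.norm_of_nonneg (by positivity)] at hx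
  have h2 : c * ‖x - p‖ ^ (-lam) ≤ ‖x - p‖ ^ (2 - (n : ℝ)) := by
    have : ‖x - p‖ ^ (-lam) = ‖x - p‖ ^ ((n : ℝ) - 2 - lam) * ‖x - p‖ ^ (2 - (n : ℝ)) := by
      rw [← Real.rpow_add hr]; congr 1; ring
    rw [this, ← mul_assoc]
    exact mul_le_of_le_one_left (by positivity) h1.le
  have h3 : a ^ m * ‖x - p‖ ^ (2 - (n : ℝ)) ≤ κ ^ m * ‖x - p‖ ^ (2 - (n : ℝ)) := by gcongr
  have := (le_abs_self _).trans hx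
  linarith

theorem HasSingularAsymptotics.exists_abs_sub_le {a : ℝ} {w₁ w₂ : EuclideanSpace ℝ (Fin n) → ℝ}
    (h₁ : HasSingularAsymptotics m a lam p w₁) (h₂ : HasSingularAsymptotics m a lam p w₂) :
    ∃ N > 0, ∃ r > 0, ∀ x, x ≠ p → ‖x - p‖ < r →
      |w₁ x ^ m - w₂ x ^ m| ≤ N * ‖x - p‖ ^ (-lam) := by
  obtain ⟨c, hc0, hc⟩ := (h₁.sub h₂).exists_pos
  refine ⟨c, hc0, eventually_nhdsNE_iff_norm.1 ?_⟩
  filter_upwards [hc.bound] with x hx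
  rw [Real.norm_eq_abs, Real.norm_of_nonneg (by positivity)] at hx
  simpa using hx

theorem le_of_rpow_le {w K r : ℝ} (hm₀ : 0 < m) (hw : 0 < w) (hK : 0 ≤ K) (hr : 0 < r)
    (h : w ^ m ≤ K * r ^ (2 - (n : ℝ))) : w ≤ K ^ m⁻¹ * r ^ (-(((n : ℝ) - 2) / m)) := by
  have h1 := Real.rpow_le_rpow (by positivity) h (inv_nonneg.2 hm₀.le)
  rw [← Real.rpow_mul hw.le, mul_inv_cancel₀ hm₀.ne', Real.rpow_one,
    Real.mul_rpow hK (by positivity), ← Real.rpow_mul hr.le] at h1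
  convert h1 using 3
  field_simp
  ring

/-- The mass of a singular profile on the annulus carrying the cutoff `ζ`. -/
theorem exists_integral_annulus_le (hm₀ : 0 < m) {K : ℝ} (hK : 0 ≤ K) (hn : 2 ≤ (n : ℝ))
    {ζ : EuclideanSpace ℝ (Fin n) → ℝ} (hζ₀ : ∀ x, 0 ≤ ζ x) (hζ₁ : ∀ x, ζ x ≤ 1)
    (hin : ∀ x, ‖x‖ ≤ 1 / 2 → ζ x = 0) (hout : ∀ x, 4 ≤ ‖x‖ → ζ x = 0) :
    ∃ C : ℝ, 0 ≤ C ∧ ∀ (p : EuclideanSpace ℝ (Fin n)) (w : EuclideanSpace ℝ (Fin n) → ℝ) (r ε : ℝ),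
      0 < ε → 4 * ε < r → (∀ x, x ≠ p → 0 < w x) →
      (∀ x, x ≠ p → ‖x - p‖ < r → w x ^ m ≤ K * ‖x - p‖ ^ (2 - (n : ℝ))) →
      ∫ x, |w x| * rescale ζ p ε x ≤ C * ε ^ ((n : ℝ) - ((n : ℝ) - 2) / m) := by
  set b := volume.real (Metric.ball (0 : EuclideanSpace ℝ (Fin n)) 1)
  have hb : 0 ≤ b := measureReal_nonneg
  set e := ((n : ℝ) - 2) / m with he
  have he0 : 0 ≤ e := div_nonneg (by linarith) hm₀.le
  refine ⟨K ^ m⁻¹ * (1 / 2) ^ (-e) * (4 ^ (n : ℝ) * b), by positivity,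
    fun p w r ε hε hr hw hle => ?_⟩
  have h := setIntegral_closedBall_const_le (p := p) (r := 4 * ε)
    (g := fun x => |w x| * rescale ζ p ε x) (B := K ^ m⁻¹ * (1 / 2 * ε) ^ (-e))
    (by positivity) (fun x => mul_nonneg (abs_nonneg _) (hζ₀ _))
    (ae_of_all _ fun x => ?_) (fun x hx => by rw [rescale_eq_zero hout hε hx.le, mul_zero])
  · refine h.trans_eq ?_
    rw [Real.mul_rpow (by norm_num) hε.le, Real.mul_rpow (by norm_num) hε.le,
      sub_eq_add_neg (n : ℝ), Real.rpow_add hε]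
    ring
  · rcases le_or_gt ‖x - p‖ (1 / 2 * ε) with hx | hx
    · rw [rescale_eq_zero' hin hε hx, mul_zero]
      positivity
    rcases le_or_gt (4 * ε) ‖x - p‖ with hx' | hx'
    · rw [rescale_eq_zero hout hε hx', mul_zero]
      positivity
    have hpos : 0 < ‖x - p‖ := lt_trans (by positivity) hx
    have hxp : x ≠ p := sub_ne_zero.1 (norm_pos_iff.1 hpos)
    calc |w x| * rescale ζ p ε x ≤ |w x| * 1 := by
          gcongr
          exact hζ₁ _
      _ = w x := by rw [mul_one, abs_of_pos (hw x hxp)]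
      _ ≤ K ^ m⁻¹ * ‖x - p‖ ^ (-e) :=
          le_of_rpow_le hm₀ (hw x hxp) hK hpos (hle x hxp (hx'.trans hr))
      _ ≤ _ := by
          refine mul_le_mul_of_nonneg_left ?_ (by positivity)
          exact Real.rpow_le_rpow_of_nonpos (by positivity) hx.le (by linarith)

/-- The `L¹` distance of two profiles with the same singularity on a small ball. -/
theorem exists_integral_ball_le (hm₀ : 0 < m) (hm₁ : m < 1) (hlam : lam < (n : ℝ) - 2)
    (hn : 1 ≤ n) (ha : 0 < (n : ℝ) - ((n : ℝ) - 2) / m)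
    {η : EuclideanSpace ℝ (Fin n) → ℝ} (hη₀ : ∀ x, 0 ≤ η x) (hη₁ : ∀ x, η x ≤ 1)
    (hout : ∀ x, 2 ≤ ‖x‖ → η x = 0)
    {w₁ w₂ : EuclideanSpace ℝ (Fin n) → ℝ} {K N r : ℝ} (hK : 0 ≤ K) (hN : 0 ≤ N)
    (hw₁ : ∀ x, x ≠ p → 0 < w₁ x) (hw₂ : ∀ x, x ≠ p → 0 < w₂ x)
    (hle₁ : ∀ x, x ≠ p → ‖x - p‖ < r → w₁ x ^ m ≤ K * ‖x - p‖ ^ (2 - (n : ℝ)))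
    (hle₂ : ∀ x, x ≠ p → ‖x - p‖ < r → w₂ x ^ m ≤ K * ‖x - p‖ ^ (2 - (n : ℝ)))
    (hsub : ∀ x, x ≠ p → ‖x - p‖ < r → |w₁ x ^ m - w₂ x ^ m| ≤ N * ‖x - p‖ ^ (-lam)) :
    ∃ C : ℝ, 0 ≤ C ∧ ∀ ε, 0 < ε → 2 * ε < r →
      ∫ x, |w₁ x - w₂ x| * rescale η p ε x ≤
        C * ε ^ ((n : ℝ) - ((n : ℝ) - 2) / m + ((n : ℝ) - 2 - lam)) := by
  set e := ((n : ℝ) - 2) / m with he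
  have hem : e * m = (n : ℝ) - 2 := by rw [he]; field_simp
  -- Here `e = (n-2)/m` is the growth exponent of the profiles. The mean value inequality gives `|w₁
  -- - w₂| ≲ ‖x - p‖^(-s)`, and `s = e - (n-2-lam) < e < n` makes this integrable.
  set s := e * (1 - m) + lam with hs
  have hsn : s < n := by nlinarith
  obtain ⟨C, hC, hint⟩ := exists_setIntegral_norm_rpow_le (n := n) hn hsn
  set D := m⁻¹ * (K ^ m⁻¹) ^ (1 - m) * N
  have hD : 0 ≤ D := by positivity
  have hexp : (n : ℝ) - e + ((n : ℝ) - 2 - lam) = n - s := by rw [hs, ← hem]; ring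
  refine ⟨D * (C * 2 ^ ((n : ℝ) - s)), by positivity, fun ε hε hr => ?_⟩
  obtain ⟨h1, h2⟩ := hint p (2 * ε) (by positivity)
  have hm := Metric.isClosed_closedBall (x := p) (ε := 2 * ε) |>.measurableSet
  calc ∫ x, |w₁ x - w₂ x| * rescale η p ε x
      ≤ ∫ x, (Metric.closedBall p (2 * ε)).indicator (fun x => D * ‖x - p‖ ^ (-s)) x := by
        refine integral_mono_of_nonneg (ae_of_all _ fun x => mul_nonneg (abs_nonneg _) (hη₀ _))
          ((integrable_indicator_iff hm).2 (h1.const_mul D)) ?_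
        filter_upwards [ae_ne_point hn p] with x hx
        have hpos : 0 < ‖x - p‖ := norm_pos_iff.2 (sub_ne_zero.2 hx)
        by_cases hxb : x ∈ Metric.closedBall p (2 * ε)
        · rw [indicator_of_mem hxb]
          have hxr : ‖x - p‖ < r := (mem_closedBall_iff_norm.1 hxb).trans_lt hr
          calc |w₁ x - w₂ x| * rescale η p ε x ≤ |w₁ x - w₂ x| * 1 := by
                gcongr
                exact hη₁ _
            _ = |w₁ x - w₂ x| := mul_one _
            _ ≤ m⁻¹ * (K ^ m⁻¹ * ‖x - p‖ ^ (-e)) ^ (1 - m) * |w₁ x ^ m - w₂ x ^ m| :=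
                abs_sub_le_mul_abs_rpow_sub_rpow hm₀ hm₁.le (hw₁ x hx) (hw₂ x hx)
                  (le_of_rpow_le hm₀ (hw₁ x hx) hK hpos (hle₁ x hx hxr))
                  (le_of_rpow_le hm₀ (hw₂ x hx) hK hpos (hle₂ x hx hxr))
            _ ≤ m⁻¹ * (K ^ m⁻¹ * ‖x - p‖ ^ (-e)) ^ (1 - m) * (N * ‖x - p‖ ^ (-lam)) := by
                gcongr
                exact hsub x hx hxr
            _ = D * ‖x - p‖ ^ (-s) := by
                rw [Real.mul_rpow (by positivity) (by positivity), ← Real.rpow_mul hpos.le,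
                  show -s = -e * (1 - m) + -lam by rw [hs]; ring, Real.rpow_add hpos]
                ring
        · rw [indicator_of_notMem hxb]
          rw [mem_closedBall_iff_norm, not_le] at hxb
          rw [rescale_eq_zero hout hε hxb.le, mul_zero]
    _ = D * ∫ x in Metric.closedBall p (2 * ε), ‖x - p‖ ^ (-s) := by
        rw [integral_indicator hm, integral_const_mul]
    _ ≤ D * (C * (2 * ε) ^ ((n : ℝ) - s)) := by gcongr
    _ = _ := by
        rw [hexp, Real.mul_rpow (by norm_num) hε.le]
        ring

end LocalEstimates

/-! ### Flux through an annulus of radius `ε` around the singularity. -/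

section Flux

variable {n : ℕ} {m lam : ℝ} {ξ : ℝ → EuclideanSpace ℝ (Fin n)} {k : ℝ → ℝ}
  {u₀ : EuclideanSpace ℝ (Fin n) → ℝ} {u u₁ u₂ : EuclideanSpace ℝ (Fin n) → ℝ → ℝ}

/-- The exponent `e = n - (n-2)/m` is the one for which a mass of order `ε^e` on the annulus gives a
flux of order one, and so changes by an amount of its own order in time `ε^e`. -/
theorem parabolic_scaling (hm₀ : 0 < m) {ε : ℝ} (hε : 0 < ε) :
    (ε⁻¹) ^ 2 * ε ^ ((n : ℝ) * (1 - m)) * (ε ^ ((n : ℝ) - ((n : ℝ) - 2) / m)) ^ m = 1 := by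
  rw [← Real.rpow_mul hε.le, sub_mul, div_mul_cancel₀ _ hm₀.ne', inv_pow, ← Real.rpow_natCast ε 2,
    ← Real.rpow_neg hε.le, ← Real.rpow_add hε, ← Real.rpow_add hε]
  convert Real.rpow_zero ε using 2
  push_cast
  ring

/-- A bound sublinear in `μ` itself closes: once `μ > 1`, the right side is at most `(A + B) μ^m`,
and `μ^m` can be divided out. -/
theorem le_of_le_add_mul_rpow (hm₀ : 0 < m) (hm₁ : m < 1) {μ A B : ℝ} (hA : 0 ≤ A)
    (h : μ ≤ A + B * μ ^ m) : μ ≤ max 1 ((A + B) ^ (1 - m)⁻¹) := by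
  rcases le_or_gt μ 1 with h1 | h1
  · exact h1.trans (le_max_left _ _)
  · have hμ : 0 < μ := by linarith
    have h2 : 1 ≤ μ ^ m := Real.one_le_rpow h1.le hm₀.le
    have h3 : μ ≤ (A + B) * μ ^ m := by nlinarith
    have h4 : μ ^ (1 - m) ≤ A + B := by
      rw [Real.rpow_sub hμ, Real.rpow_one, div_le_iff₀ (by positivity)]
      exact h3
    have h5 := Real.rpow_le_rpow (by positivity) h4 (inv_nonneg.2 (sub_nonneg.2 hm₁.le))
    rw [← Real.rpow_mul hμ.le, mul_inv_cancel₀ (by linarith), Real.rpow_one] at h5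
    exact h5.trans (le_max_right _ _)

theorem IsSingularSolution.abs_rpow_ae_eq (h : IsSingularSolution m lam ξ k u₀ u) (hn : 1 ≤ n)
    {t : ℝ} (ht : 0 ≤ t) : ∀ᵐ x, |u x t ^ m| = |u x t| ^ m := by
  filter_upwards [ae_ne_point hn (ξ t)] with x hx
  have := h.pos t ht x hx
  rw [abs_of_pos this, abs_of_pos (by positivity)]

theorem abs_rpow_sub_rpow_ae_le (hm₀ : 0 < m) (hm₁ : m < 1) (hn : 1 ≤ n)
    (h₁ : IsSingularSolution m lam ξ k u₀ u₁) (h₂ : IsSingularSolution m lam ξ k u₀ u₂)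
    {t : ℝ} (ht : 0 ≤ t) : ∀ᵐ x, |u₁ x t ^ m - u₂ x t ^ m| ≤ |u₁ x t - u₂ x t| ^ m := by
  filter_upwards [ae_ne_point hn (ξ t)] with x hx
  exact abs_rpow_sub_rpow_le hm₀ hm₁.le (h₁.pos t ht x hx).le (h₂.pos t ht x hx).le

/-- The mass on an annulus of radius `ε` is controlled backward during the intrinsic time. -/
theorem exists_backward_bound (hm₀ : 0 < m) (hm₁ : m < 1) (hn : 1 ≤ n)
    {ζ : EuclideanSpace ℝ (Fin n) → ℝ} (hζ : ContDiff ℝ 2 ζ) (hc : HasCompactSupport ζ)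
    (hζ₀ : ∀ x, 0 ≤ ζ x) (hin : ∀ x, ‖x‖ ≤ 1 / 2 → ζ x = 0) {C C₁ : ℝ} (hC : 0 ≤ C)
    (hL : ∀ x, |Laplacian.laplacian ζ x| ≤ C * ζ x ^ m) (hC₁ : 0 ≤ C₁) :
    ∃ C₂ : ℝ, 0 ≤ C₂ ∧ ∀ (u : EuclideanSpace ℝ (Fin n) → ℝ → ℝ),
      IsSingularSolution m lam ξ k u₀ u → ∀ t ε : ℝ, 0 < ε →
      ε ^ ((n : ℝ) - ((n : ℝ) - 2) / m) < t →
      (∀ τ ∈ Icc (t - ε ^ ((n : ℝ) - ((n : ℝ) - 2) / m)) t, ‖ξ τ - ξ t‖ ≤ ε / 4) →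
      ∫ x, |u x t| * rescale ζ (ξ t) ε x ≤ C₁ * ε ^ ((n : ℝ) - ((n : ℝ) - 2) / m) →
      ∀ τ ∈ Icc (t - ε ^ ((n : ℝ) - ((n : ℝ) - 2) / m)) t,
        ∫ x, |u x τ| * rescale ζ (ξ t) ε x ≤ C₂ * ε ^ ((n : ℝ) - ((n : ℝ) - 2) / m) := by
  obtain ⟨C', hC', hHP⟩ := exists_integral_rpow_mul_le hm₀ hm₁.le hc hζ₀ hC hL
  refine ⟨max 1 ((C₁ + C') ^ (1 - m)⁻¹), by positivity, fun u h t ε hε ht hξ hY => ?_⟩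
  set e := (n : ℝ) - ((n : ℝ) - 2) / m with he
  set h' := ε ^ e with hh'
  have hh0 : 0 < h' := by positivity
  set p := ξ t
  have hφ := contDiff_rescale hζ p ε
  have hφc := hasCompactSupport_rescale hc p hε
  set Y : ℝ → ℝ := fun τ => ∫ x, |u x τ| * rescale ζ p ε x with hYdef
  have hYc : ContinuousOn Y (Icc (t - h') t) :=
    (h.continuousL1Loc.continuousOn_integral hφ.continuous hφc).mono fun τ hτ =>
      (by linarith [hτ.1] : (0 : ℝ) ≤ τ)
  have hY0 : ∀ τ, 0 ≤ Y τ := fun τ => integral_nonneg fun x => mul_nonneg (abs_nonneg _) (hζ₀ _)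
  -- On `[s, t]` every flux is at most a multiple of `Y s ^ m`, with `Y s` the maximal mass.
  -- Integrating back from `t` to `s` therefore bounds `Y s` by the terminal mass plus a sublinear
  -- term in `Y s`.
  obtain ⟨s, hs, hmax⟩ := isCompact_Icc.exists_isMaxOn ⟨t, by simp [hh0.le]⟩ hYc
  have hs0 : 0 < s := by linarith [hs.1]
  have hflux : ∀ τ ∈ Icc s t, ∫ x, |u x τ ^ m| * |Laplacian.laplacian (rescale ζ p ε) x| ≤
      (ε⁻¹) ^ 2 * (C' * ε ^ ((n : ℝ) * (1 - m)) * Y s ^ m) := by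
    intro τ hτ
    have hτ' : τ ∈ Icc (t - h') t := ⟨hs.1.trans hτ.1, hτ.2⟩
    have hτ0 : 0 ≤ τ := hs0.le.trans hτ.1
    have h1 := hHP p ε hε (fun x => |u x τ|) (fun x => abs_nonneg _)
      (h.continuousL1Loc.integrable_abs_mul hφ.continuous hφc hτ0)
      (fun x => |u x τ ^ m| * |Laplacian.laplacian ζ (ε⁻¹ • (x - p))|)
      (fun x => by positivity) (by
        filter_upwards [h.abs_rpow_ae_eq hn hτ0] with x hx
        rw [hx])
    have h2 : ∀ x, |u x τ ^ m| * |Laplacian.laplacian (rescale ζ p ε) x| =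
        (ε⁻¹) ^ 2 * (|u x τ ^ m| * |Laplacian.laplacian ζ (ε⁻¹ • (x - p))|) := fun x => by
      rw [laplacian_rescale hζ, abs_mul, abs_of_nonneg (by positivity : 0 ≤ (ε⁻¹) ^ 2)]
      ring
    simp only [h2]
    rw [integral_const_mul]
    refine mul_le_mul_of_nonneg_left (h1.trans ?_) (by positivity)
    have h3 : Y τ ^ m ≤ Y s ^ m := Real.rpow_le_rpow (hY0 τ) (hmax hτ') hm₀.le
    exact mul_le_mul_of_nonneg_left h3 (by positivity)
  have hmass := h.integral_abs_le hφ hφc hs0 hs.2 (fun τ hτ => by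
    -- The curve stays within `ε/4` of `p`, while the rescaled `ζ` vanishes up to distance `ε/2`.
    refine notMem_tsupport_of_forall_ball (p := p) (r := ε / 2) (fun x hx => ?_) ?_
    · exact rescale_eq_zero' hin hε (by linarith)
    · exact (hξ τ ⟨hs.1.trans hτ.1, hτ.2⟩).trans_lt (by linarith))
    intervalIntegrable_const hflux
  rw [intervalIntegral.integral_const, smul_eq_mul] at hmass
  have hYs : Y s ≤ C₁ * h' + h' * ((ε⁻¹) ^ 2 * (C' * ε ^ ((n : ℝ) * (1 - m)) * Y s ^ m)) := by
    refine hmass.trans (add_le_add hY (mul_le_mul_of_nonneg_right (by linarith [hs.1]) ?_))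
    have := hY0 s
    positivity
  have hμ : Y s / h' ≤ C₁ + C' * (Y s / h') ^ m := by
    have hsc := parabolic_scaling (n := n) hm₀ hε
    rw [← he, ← hh'] at hsc
    have hhm : 0 < h' ^ m := by positivity
    rw [div_le_iff₀ hh0, Real.div_rpow (hY0 s) hh0.le]
    refine hYs.trans_eq ?_
    have h4 : (ε⁻¹) ^ 2 * ε ^ ((n : ℝ) * (1 - m)) = (h' ^ m)⁻¹ := eq_inv_of_mul_eq_one_left hsc
    calc _ = C₁ * h' + h' * (C' * ((ε⁻¹) ^ 2 * ε ^ ((n : ℝ) * (1 - m))) * Y s ^ m) := by ring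
      _ = _ := by rw [h4]; ring
  have hbound := le_of_le_add_mul_rpow hm₀ hm₁ hC₁ hμ
  rw [div_le_iff₀ hh0] at hbound
  exact fun τ hτ => (hmax hτ).trans hbound

/-- The flux through a small sphere is bounded as long as the masses on an annulus are. -/
theorem exists_flux_bound (hm₀ : 0 < m) (hm₁ : m < 1) (hn : 1 ≤ n)
    {η ζ : EuclideanSpace ℝ (Fin n) → ℝ} (hη : ContDiff ℝ 2 η)
    (hζ : ContDiff ℝ 2 ζ) (hc : HasCompactSupport ζ)
    (hζ₀ : ∀ x, 0 ≤ ζ x) {C C₂ : ℝ} (hC : 0 ≤ C)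
    (hL : ∀ x, |Laplacian.laplacian η x| ≤ C * ζ x ^ m) (hC₂ : 0 ≤ C₂) :
    ∃ C₃ : ℝ, 0 ≤ C₃ ∧ ∀ (u₁ u₂ : EuclideanSpace ℝ (Fin n) → ℝ → ℝ),
      IsSingularSolution m lam ξ k u₀ u₁ → IsSingularSolution m lam ξ k u₀ u₂ →
      ∀ (p : EuclideanSpace ℝ (Fin n)) (τ ε : ℝ), 0 < ε → 0 ≤ τ →
      ∫ x, |u₁ x τ| * rescale ζ p ε x ≤ C₂ * ε ^ ((n : ℝ) - ((n : ℝ) - 2) / m) →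
      ∫ x, |u₂ x τ| * rescale ζ p ε x ≤ C₂ * ε ^ ((n : ℝ) - ((n : ℝ) - 2) / m) →
      ∫ x, |u₁ x τ ^ m - u₂ x τ ^ m| * |Laplacian.laplacian (rescale η p ε) x| ≤ C₃ := by
  obtain ⟨C', hC', hHP⟩ := exists_integral_rpow_mul_le hm₀ hm₁.le hc hζ₀ hC hL
  refine ⟨C' * (2 * C₂) ^ m, by positivity, fun u₁ u₂ h₁ h₂ p τ ε hε hτ hY₁ hY₂ => ?_⟩
  have hφ := contDiff_rescale hζ p ε
  have hφc := hasCompactSupport_rescale hc p hε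
  have hi₁ := h₁.continuousL1Loc.integrable_abs_mul hφ.continuous hφc hτ
  have hi₂ := h₂.continuousL1Loc.integrable_abs_mul hφ.continuous hφc hτ
  have hi := (h₁.continuousL1Loc.sub h₂.continuousL1Loc).integrable_abs_mul hφ.continuous hφc hτ
  set e := (n : ℝ) - ((n : ℝ) - 2) / m with he
  have hw : ∫ x, |u₁ x τ - u₂ x τ| * rescale ζ p ε x ≤ 2 * C₂ * ε ^ e := by
    have h3 : ∫ x, |u₁ x τ - u₂ x τ| * rescale ζ p ε x ≤
        ∫ x, (|u₁ x τ| * rescale ζ p ε x + |u₂ x τ| * rescale ζ p ε x) := by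
      refine integral_mono hi (hi₁.add hi₂) fun x => ?_
      simp only
      rw [← add_mul]
      exact mul_le_mul_of_nonneg_right (abs_sub _ _) (hζ₀ _)
    rw [integral_add hi₁ hi₂] at h3
    linarith
  have h1 := hHP p ε hε (fun x => |u₁ x τ - u₂ x τ|) (fun x => abs_nonneg _) hi
    (fun x => |u₁ x τ ^ m - u₂ x τ ^ m| * |Laplacian.laplacian η (ε⁻¹ • (x - p))|)
    (fun x => by positivity) (by
      filter_upwards [abs_rpow_sub_rpow_ae_le hm₀ hm₁ hn h₁ h₂ hτ] with x hx
      exact mul_le_mul_of_nonneg_right hx (abs_nonneg _))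
  have h2 : ∀ x, |u₁ x τ ^ m - u₂ x τ ^ m| * |Laplacian.laplacian (rescale η p ε) x| =
      (ε⁻¹) ^ 2 * (|u₁ x τ ^ m - u₂ x τ ^ m| * |Laplacian.laplacian η (ε⁻¹ • (x - p))|) :=
    fun x => by
      rw [laplacian_rescale hη, abs_mul, abs_of_nonneg (by positivity : 0 ≤ (ε⁻¹) ^ 2)]
      ring
  simp only [h2]
  rw [integral_const_mul]
  have h0 : 0 ≤ ∫ x, |u₁ x τ - u₂ x τ| * ζ (ε⁻¹ • (x - p)) :=
    integral_nonneg fun x => mul_nonneg (abs_nonneg _) (hζ₀ _)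
  calc _ ≤ (ε⁻¹) ^ 2 * (C' * ε ^ ((n : ℝ) * (1 - m)) * (2 * C₂ * ε ^ e) ^ m) := by
        refine mul_le_mul_of_nonneg_left (h1.trans ?_) (by positivity)
        refine mul_le_mul_of_nonneg_left ?_ (by positivity)
        exact Real.rpow_le_rpow h0 hw hm₀.le
    _ = C' * (2 * C₂) ^ m * ((ε⁻¹) ^ 2 * ε ^ ((n : ℝ) * (1 - m)) * (ε ^ e) ^ m) := by
        rw [Real.mul_rpow (by positivity) (by positivity)]
        ring
    _ = _ := by rw [parabolic_scaling hm₀ hε, mul_one]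

/-- The flux through a small sphere is small where the difference of the powers is less singular. -/
theorem exists_flux_small (hm₀ : 0 < m) (hlam₀ : 0 < lam)
    {η ζ : EuclideanSpace ℝ (Fin n) → ℝ} (hη : ContDiff ℝ 2 η)
    (hin : ∀ x, ‖x‖ ≤ 1 / 2 → ζ x = 0) (hout : ∀ x, 4 ≤ ‖x‖ → ζ x = 0) {C : ℝ} (hC : 0 ≤ C)
    (hL : ∀ x, |Laplacian.laplacian η x| ≤ C * ζ x ^ m)
    (hL' : ∀ x, |Laplacian.laplacian η x| ≤ C) :
    ∃ C₄ : ℝ, 0 ≤ C₄ ∧ ∀ (z : EuclideanSpace ℝ (Fin n) → ℝ) (p q : EuclideanSpace ℝ (Fin n))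
      (ε r N : ℝ), 0 < ε → 5 * ε < r → 0 ≤ N → ‖q - p‖ ≤ ε / 4 →
      (∀ y, y ≠ q → ‖y - q‖ < r → |z y| ≤ N * ‖y - q‖ ^ (-lam)) →
      ∫ x, |z x| * |Laplacian.laplacian (rescale η p ε) x| ≤
        C₄ * N * ε ^ ((n : ℝ) - 2 - lam) := by
  set b := volume.real (Metric.ball (0 : EuclideanSpace ℝ (Fin n)) 1)
  have hb : 0 ≤ b := measureReal_nonneg
  refine ⟨(1 / 4) ^ (-lam) * C * (4 ^ (n : ℝ) * b), by positivity,
    fun z p q ε r N hε hr hN hq hz => ?_⟩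
  have hzero : ∀ x, rescale ζ p ε x = 0 → Laplacian.laplacian (rescale η p ε) x = 0 := by
    intro x hx
    have h1 := hL (ε⁻¹ • (x - p))
    rw [show ζ (ε⁻¹ • (x - p)) = 0 from hx, Real.zero_rpow hm₀.ne', mul_zero] at h1
    rw [laplacian_rescale hη, abs_eq_zero.1 (le_antisymm h1 (abs_nonneg _)), mul_zero]
  have h := setIntegral_closedBall_const_le (p := p) (r := 4 * ε)
    (g := fun x => |z x| * |Laplacian.laplacian (rescale η p ε) x|)
    (B := N * (1 / 4 * ε) ^ (-lam) * ((ε⁻¹) ^ 2 * C))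
    (by positivity) (fun x => by positivity) (ae_of_all _ fun x => ?_)
    (fun x hx => by rw [hzero x (rescale_eq_zero hout hε hx.le), abs_zero, mul_zero])
  · refine h.trans_eq ?_
    rw [Real.mul_rpow (by norm_num) hε.le, Real.mul_rpow (by norm_num) hε.le,
      show (n : ℝ) - 2 - lam = n + (-(2 : ℕ) + -lam) by push_cast; ring, Real.rpow_add hε,
      Real.rpow_add hε, Real.rpow_neg hε.le ((2 : ℕ) : ℝ), Real.rpow_natCast ε 2, inv_pow]
    ring
  · rcases le_or_gt ‖x - p‖ (1 / 2 * ε) with hx | hx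
    · rw [hzero x (rescale_eq_zero' hin hε hx), abs_zero, mul_zero]
      positivity
    rcases le_or_gt (4 * ε) ‖x - p‖ with hx' | hx'
    · rw [hzero x (rescale_eq_zero hout hε hx'), abs_zero, mul_zero]
      positivity
    have hqx : ‖x - p‖ ≤ ‖x - q‖ + ‖q - p‖ := norm_sub_le_norm_sub_add_norm_sub x q p
    have hqx' : ‖x - q‖ ≤ ‖x - p‖ + ‖q - p‖ := by
      rw [norm_sub_rev q p]; exact norm_sub_le_norm_sub_add_norm_sub x p q
    -- `ε/2 - ε/4` from below. From above, `4ε + ε/4 < 5ε < r` keeps `x` in the region where the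
    -- bound on `z` holds.
    have hlow : 1 / 4 * ε ≤ ‖x - q‖ := by linarith
    have hpos : 0 < ‖x - q‖ := lt_of_lt_of_le (by positivity) hlow
    have hxq : x ≠ q := sub_ne_zero.1 (norm_pos_iff.1 hpos)
    have h1 : |z x| ≤ N * (1 / 4 * ε) ^ (-lam) :=
      (hz x hxq (by linarith)).trans (mul_le_mul_of_nonneg_left
        (Real.rpow_le_rpow_of_nonpos (by positivity) hlow (by linarith)) hN)
    rw [laplacian_rescale hη, abs_mul, abs_of_nonneg (by positivity : 0 ≤ (ε⁻¹) ^ 2)]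
    have h2 := hL' (ε⁻¹ • (x - p))
    gcongr

end Flux

/-! ### One backward time step with the singularity cut off. -/

section Increments

variable {n : ℕ} {m lam : ℝ} {ξ : ℝ → EuclideanSpace ℝ (Fin n)} {k : ℝ → ℝ}
  {u₀ : EuclideanSpace ℝ (Fin n) → ℝ} {u u₁ u₂ : EuclideanSpace ℝ (Fin n) → ℝ → ℝ}

theorem exists_far_bound (hm₀ : 0 < m) (hm₁ : m < 1) (hn : 1 ≤ n)
    {ψ : EuclideanSpace ℝ (Fin n) → ℝ} (hψ : ContDiff ℝ 2 ψ) (hc : HasCompactSupport ψ)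
    (hψ₀ : ∀ x, 0 ≤ ψ x) {C : ℝ} (hC : 0 ≤ C)
    (hL : ∀ x, |Laplacian.laplacian ψ x| ≤ C * ψ x ^ m)
    (h₁ : IsSingularSolution m lam ξ k u₀ u₁) (h₂ : IsSingularSolution m lam ξ k u₀ u₂) :
    ∃ C' : ℝ, 0 ≤ C' ∧ ∀ R τ : ℝ, 0 < R → 0 ≤ τ →
      ∫ x, |u₁ x τ ^ m - u₂ x τ ^ m| * |Laplacian.laplacian (rescale ψ 0 R) x| ≤
        C' * ((R⁻¹) ^ 2 * R ^ ((n : ℝ) * (1 - m))) *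
          (∫ x, |u₁ x τ - u₂ x τ| * rescale ψ 0 R x) ^ m := by
  obtain ⟨C', hC', hHP⟩ := exists_integral_rpow_mul_le hm₀ hm₁.le hc hψ₀ hC hL
  refine ⟨C', hC', fun R τ hR hτ => ?_⟩
  have hi := (h₁.continuousL1Loc.sub h₂.continuousL1Loc).integrable_abs_mul
    (contDiff_rescale hψ 0 R).continuous (hasCompactSupport_rescale hc 0 hR) hτ
  have h1 := hHP 0 R hR (fun x => |u₁ x τ - u₂ x τ|) (fun x => abs_nonneg _) hi
    (fun x => |u₁ x τ ^ m - u₂ x τ ^ m| * |Laplacian.laplacian ψ (R⁻¹ • (x - 0))|)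
    (fun x => by positivity) (by
      filter_upwards [abs_rpow_sub_rpow_ae_le hm₀ hm₁ hn h₁ h₂ hτ] with x hx
      exact mul_le_mul_of_nonneg_right hx (abs_nonneg _))
  have h2 : ∀ x, |u₁ x τ ^ m - u₂ x τ ^ m| * |Laplacian.laplacian (rescale ψ 0 R) x| =
      (R⁻¹) ^ 2 * (|u₁ x τ ^ m - u₂ x τ ^ m| * |Laplacian.laplacian ψ (R⁻¹ • (x - 0))|) :=
    fun x => by
      rw [laplacian_rescale hψ, abs_mul, abs_of_nonneg (by positivity : 0 ≤ (R⁻¹) ^ 2)]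
      ring
  simp only [h2]
  rw [integral_const_mul]
  calc _ ≤ (R⁻¹) ^ 2 * (C' * R ^ ((n : ℝ) * (1 - m)) *
        (∫ x, |u₁ x τ - u₂ x τ| * rescale ψ 0 R x) ^ m) :=
        mul_le_mul_of_nonneg_left h1 (by positivity)
    _ = _ := by ring

/-- One step of the `L¹` estimate: cut a ball of radius `ε` around the singularity off. -/
theorem integral_abs_sub_le_add (hm₀ : 0 < m)
    (h₁ : IsSingularSolution m lam ξ k u₀ u₁) (h₂ : IsSingularSolution m lam ξ k u₀ u₂)
    {ψ η : EuclideanSpace ℝ (Fin n) → ℝ} {R ε s t : ℝ} {p : EuclideanSpace ℝ (Fin n)}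
    (hψ : ContDiff ℝ 2 ψ) (hψc : HasCompactSupport ψ) (hψ₀ : ∀ x, 0 ≤ ψ x)
    (hψ₁ : ∀ x, ‖x‖ ≤ R → ψ x = 1)
    (hη : ContDiff ℝ 2 η) (hηc : HasCompactSupport η) (hη₀ : ∀ x, 0 ≤ η x) (hηle : ∀ x, η x ≤ 1)
    (hη₁ : ∀ x, ‖x - p‖ ≤ ε → η x = 1) (hη₂ : ∀ x, 2 * ε ≤ ‖x - p‖ → η x = 0)
    (hε : 0 < ε) (hR : ‖p‖ + 2 * ε ≤ R) (hs : 0 < s) (hst : s ≤ t)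
    (hξ : ∀ τ ∈ Icc s t, ‖ξ τ - p‖ ≤ ε / 4)
    {g : ℝ → ℝ} (hg : IntervalIntegrable g volume s t)
    (hle : ∀ τ ∈ Icc s t, (∫ x, |u₁ x τ ^ m - u₂ x τ ^ m| * |Laplacian.laplacian ψ x|) +
      (∫ x, |u₁ x τ ^ m - u₂ x τ ^ m| * |Laplacian.laplacian η x|) ≤ g τ) :
    ∫ x, |u₁ x t - u₂ x t| * ψ x ≤ (∫ x, |u₁ x s - u₂ x s| * ψ x) +
      (∫ x, |u₁ x t - u₂ x t| * η x) + ∫ τ in s..t, g τ := by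
  have hw := h₁.continuousL1Loc.sub h₂.continuousL1Loc
  -- The test function `ψ - η` vanishes near the curve, and is nonnegative because `ψ = 1` wherever
  -- `η ≠ 0`.
  have hφc : HasCompactSupport fun x => ψ x - η x := hψc.sub hηc
  have hφ : ContDiff ℝ 2 fun x => ψ x - η x := hψ.sub hη
  have hφ₀ : ∀ x, 0 ≤ ψ x - η x := by
    intro x
    rcases le_or_gt (2 * ε) ‖x - p‖ with hx | hx
    · rw [hη₂ x hx, sub_zero]; exact hψ₀ x
    · have : ‖x‖ ≤ ‖x - p‖ + ‖p‖ := by simpa using norm_add_le (x - p) p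
      rw [hψ₁ x (by linarith)]
      linarith [hηle x]
  have hballψ : ∀ x, ‖x - p‖ < ε → ψ x = 1 := fun x hx => by
    have : ‖x‖ ≤ ‖x - p‖ + ‖p‖ := by simpa using norm_add_le (x - p) p
    exact hψ₁ x (by linarith)
  have hlapψ : ∀ x, ‖x - p‖ < ε → Laplacian.laplacian ψ x = 0 :=
    laplacian_eq_zero_of_forall_ball hballψ
  have hlapη : ∀ x, ‖x - p‖ < ε → Laplacian.laplacian η x = 0 :=
    laplacian_eq_zero_of_forall_ball fun x hx => hη₁ x hx.le
  have hξ' : ∀ τ ∈ Icc s t, ‖ξ τ - p‖ < ε := fun τ hτ => (hξ τ hτ).trans_lt (by linarith)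
  have hmain := h₁.integral_abs_sub_le hm₀ h₂ hφ hφc hφ₀ hs hst (fun τ hτ =>
    notMem_tsupport_of_forall_ball (p := p) (r := ε)
      (fun x hx => by rw [hballψ x hx, hη₁ x hx.le, sub_self]) (hξ' τ hτ)) hg
    fun τ hτ => by
      refine le_trans ?_ (hle τ hτ)
      have hzc : ∀ x, x ≠ ξ τ → ContinuousAt (fun x => |u₁ x τ ^ m - u₂ x τ ^ m|) x :=
        fun x hx => ((h₁.contDiffAt_rpow (hs.trans_le hτ.1) hx).continuousAt.sub
          (h₂.contDiffAt_rpow (hs.trans_le hτ.1) hx).continuousAt).abs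
      have hint : ∀ θ : EuclideanSpace ℝ (Fin n) → ℝ, ContDiff ℝ 2 θ → HasCompactSupport θ →
          (∀ x, ‖x - p‖ < ε → Laplacian.laplacian θ x = 0) →
          Integrable fun x => |u₁ x τ ^ m - u₂ x τ ^ m| * |Laplacian.laplacian θ x| := by
        intro θ hθ hθc hθ0
        refine integrable_mul_of_continuousAt hθ.continuous_laplacian.abs
          (hθc.laplacian.comp_left (g := fun y : ℝ => |y|) abs_zero) fun x hx => hzc x ?_
        rintro rfl
        exact notMem_tsupport_of_forall_ball (p := p) (r := ε)
          (fun x hx => by simp only [hθ0 x hx, abs_zero]) (hξ' τ hτ) hx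
      rw [← integral_add (hint ψ hψ hψc hlapψ) (hint η hη hηc hlapη)]
      refine (le_abs_self _).trans (abs_integral_le_integral_abs.trans ?_)
      refine integral_mono_of_nonneg (ae_of_all _ fun x => abs_nonneg _)
        ((hint ψ hψ hψc hlapψ).add (hint η hη hηc hlapη)) (ae_of_all _ fun x => ?_)
      have hsub : Laplacian.laplacian (fun x => ψ x - η x) x =
          Laplacian.laplacian ψ x - Laplacian.laplacian η x :=
        hψ.contDiffAt.laplacian_sub hη.contDiffAt
      simp only
      rw [hsub, abs_mul, abs_abs, ← mul_add]
      exact mul_le_mul_of_nonneg_left (abs_sub _ _) (abs_nonneg _)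
  have ht : 0 ≤ t := hs.le.trans hst
  -- The inner mass at the earlier time `s` is dropped by sign. Only the one at the final time `t`
  -- survives, so the asymptotics at the single time `t` suffice to estimate it.
  have e1 : ∫ x, |u₁ x t - u₂ x t| * (ψ x - η x) =
      (∫ x, |u₁ x t - u₂ x t| * ψ x) - ∫ x, |u₁ x t - u₂ x t| * η x := by
    rw [← integral_sub (hw.integrable_abs_mul hψ.continuous hψc ht)
      (hw.integrable_abs_mul hη.continuous hηc ht)]
    simp only [mul_sub]
  have e2 : ∫ x, |u₁ x s - u₂ x s| * (ψ x - η x) ≤ ∫ x, |u₁ x s - u₂ x s| * ψ x :=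
    integral_mono (hw.integrable_abs_mul hφ.continuous hφc hs.le)
      (hw.integrable_abs_mul hψ.continuous hψc hs.le) fun x =>
        mul_le_mul_of_nonneg_left (by linarith [hη₀ x]) (abs_nonneg _)
  linarith

end Increments

/-! ### Exhaustion of time by sets on which the asymptotics are uniform. -/

section GoodTimes

variable {n : ℕ}

/-- The times at which `z` is bounded by `N |x - ξ(t)|⁻ˡᵃᵐ` in the ball of radius `1 / (N + 1)`. -/
def goodTimes (z : EuclideanSpace ℝ (Fin n) → ℝ → ℝ) (ξ : ℝ → EuclideanSpace ℝ (Fin n))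
    (lam : ℝ) (N : ℕ) : Set ℝ :=
  {τ | ∀ y : EuclideanSpace ℝ (Fin n), y ≠ 0 → ‖y‖ < 1 / ((N : ℝ) + 1) →
    |z (ξ τ + y) τ| ≤ N * ‖y‖ ^ (-lam)}

variable {z : EuclideanSpace ℝ (Fin n) → ℝ → ℝ} {ξ : ℝ → EuclideanSpace ℝ (Fin n)} {lam : ℝ}

theorem monotone_goodTimes : Monotone (goodTimes z ξ lam) := by
  intro M N hMN τ hτ y hy hyN
  have hMN' : (M : ℝ) ≤ N := by exact_mod_cast hMN
  refine (hτ y hy (hyN.trans_le ?_)).trans ?_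
  · gcongr
  · gcongr

/-- For a fixed displacement `y ≠ 0` the point `ξ τ + y` stays off the curve, so each condition is
closed in `τ`. This supplies the measurability of the sets of bad times. -/
theorem isClosed_Icc_inter_goodTimes (hξ : ContinuousOn ξ (Ici 0))
    (hz : ContinuousOn (fun p : EuclideanSpace ℝ (Fin n) × ℝ => z p.1 p.2)
      {p | p.1 ≠ ξ p.2 ∧ 0 ≤ p.2}) (T : ℝ) (N : ℕ) :
    IsClosed (Icc 0 T ∩ goodTimes z ξ lam N) := by
  have h : Icc 0 T ∩ goodTimes z ξ lam N = Icc 0 T ∩ ⋂ y : EuclideanSpace ℝ (Fin n),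
      ⋂ _ : y ≠ 0 ∧ ‖y‖ < 1 / ((N : ℝ) + 1),
        (Icc 0 T ∩ (fun τ => |z (ξ τ + y) τ|) ⁻¹' Iic (N * ‖y‖ ^ (-lam))) := by
    ext τ
    simp only [goodTimes, mem_inter_iff, mem_ofPred_eq, mem_iInter, mem_preimage, mem_Iic]
    exact ⟨fun ⟨h1, h2⟩ => ⟨h1, fun y hy => ⟨h1, h2 y hy.1 hy.2⟩⟩,
      fun ⟨h1, h2⟩ => ⟨h1, fun y hy hy' => (h2 y ⟨hy, hy'⟩).2⟩⟩
  rw [h]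
  refine isClosed_Icc.inter (isClosed_iInter fun y => isClosed_iInter fun hy => ?_)
  refine ContinuousOn.preimage_isClosed_of_isClosed ?_ isClosed_Icc isClosed_Iic
  refine (hz.comp (f := fun τ => (ξ τ + y, τ)) ?_ fun τ hτ => ⟨?_, hτ.1⟩).abs
  · exact ((hξ.mono fun τ hτ => hτ.1).add continuousOn_const).prodMk continuousOn_id
  · simpa using hy.1

theorem exists_mem_goodTimes {τ N r : ℝ} (hr : 0 < r)
    (h : ∀ x, x ≠ ξ τ → ‖x - ξ τ‖ < r → |z x τ| ≤ N * ‖x - ξ τ‖ ^ (-lam)) :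
    ∃ M, τ ∈ goodTimes z ξ lam M := by
  obtain ⟨M₁, hM₁⟩ := exists_nat_ge N
  obtain ⟨M₂, hM₂⟩ := exists_nat_one_div_lt hr
  refine ⟨max M₁ M₂, fun y hy hyM => ?_⟩
  have h1 := h (ξ τ + y) (by simpa using hy) (by
    rw [add_sub_cancel_left]
    refine hyM.trans (lt_of_le_of_lt ?_ hM₂)
    gcongr
    exact le_max_right _ _)
  rw [add_sub_cancel_left] at h1
  refine h1.trans ?_
  gcongr
  exact hM₁.trans (by exact_mod_cast le_max_left _ _)

end GoodTimes

/-! ### The singular curve contributes no flux. -/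

section Main

variable {n : ℕ} {m lam : ℝ} {ξ : ℝ → EuclideanSpace ℝ (Fin n)} {k : ℝ → ℝ}
  {u₀ : EuclideanSpace ℝ (Fin n) → ℝ} {u u₁ u₂ : EuclideanSpace ℝ (Fin n) → ℝ → ℝ}

theorem eventually_mul_rpow_le {c D q : ℝ} (hq : 0 < q) (hc : 0 < c) :
    ∀ᶠ ε in 𝓝[>] (0 : ℝ), D * ε ^ q ≤ c := by
  have h : Tendsto (fun ε : ℝ => D * ε ^ q) (𝓝[>] 0) (𝓝 0) := by
    have h1 : Continuous fun ε : ℝ => D * ε ^ q :=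
      continuous_const.mul (Real.continuous_rpow_const hq.le)
    have := (h1.tendsto 0).mono_left (nhdsWithin_le_nhds (s := Ioi 0))
    simpa [Real.zero_rpow hq.ne'] using this
  exact (h.eventually (gt_mem_nhds hc)).mono fun ε h => h.le

theorem tendsto_rpow_nhdsGT_zero {e : ℝ} (he : 0 < e) :
    Tendsto (fun ε : ℝ => ε ^ e) (𝓝[>] 0) (𝓝[>] 0) := by
  refine tendsto_nhdsWithin_of_tendsto_nhds_of_eventually_within _ ?_ ?_
  · have := ((Real.continuous_rpow_const he.le).tendsto 0).mono_left
      (nhdsWithin_le_nhds (s := Ioi (0 : ℝ)))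
    simpa [Real.zero_rpow he.ne'] using this
  · filter_upwards [self_mem_nhdsWithin] with ε hε using Real.rpow_pos_of_pos hε e

/-- The weighted `L¹` distance of two solutions is controlled by the flux at infinity alone. -/
theorem exists_integral_abs_sub_le (hn : 3 ≤ n) (hm₀ : 0 < m) (hm₁ : m < 1)
    (he : 0 < (n : ℝ) - ((n : ℝ) - 2) / m) (hlam₀ : 0 < lam) (hlam : lam < (n : ℝ) - 2)
    {κ : ℝ} (hk₀ : ∀ t, 0 ≤ t → 0 ≤ k t) (hkκ : ∀ t, 0 ≤ t → k t ≤ κ)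
    (hξ : ContinuousOn ξ (Ici 0))
    (hmove : ∀ᶠ ε in 𝓝[>] (0 : ℝ), ∀ s t, 0 ≤ s → 0 ≤ t →
      |s - t| ≤ ε ^ ((n : ℝ) - ((n : ℝ) - 2) / m) → ‖ξ s - ξ t‖ ≤ ε / 4)
    (h₁ : IsSingularSolution m lam ξ k u₀ u₁) (h₂ : IsSingularSolution m lam ξ k u₀ u₂) :
    ∃ (ψ : EuclideanSpace ℝ (Fin n) → ℝ) (C : ℝ), 0 ≤ C ∧ ContDiff ℝ 2 ψ ∧ HasCompactSupport ψ ∧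
      (∀ x, 0 ≤ ψ x) ∧ (∀ x, ‖x‖ ≤ 1 → ψ x = 1) ∧
      ∀ R T : ℝ, 0 < R → (∀ s ∈ Icc 0 T, ‖ξ s‖ + 1 ≤ R) → ∀ t ∈ Icc 0 T,
        ∫ x, |u₁ x t - u₂ x t| * rescale ψ 0 R x ≤
          ∫ s in (0 : ℝ)..t, C * ((R⁻¹) ^ 2 * R ^ ((n : ℝ) * (1 - m))) *
            (∫ x, |u₁ x s - u₂ x s| * rescale ψ 0 R x) ^ m := by
  have hn1 : 1 ≤ n := by omega
  have hn2 : (2 : ℝ) ≤ n := by exact_mod_cast (by omega : 2 ≤ n)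
  have hκ : 0 ≤ κ := (hk₀ 0 le_rfl).trans (hkκ 0 le_rfl)
  obtain ⟨ψ, η, ζ, C, hC, ⟨hψ, hψc, hψ₀, hψ₁, hψL⟩,
    ⟨hη, hηc, hη₀, hηle, hη₁, hη₂, hηL, hηL'⟩,
    ⟨hζ, hζc, hζ₀, hζle, hζin, hζout, hζL⟩⟩ := exists_cutoffs n hm₁
  obtain ⟨C', hC', hfar⟩ := exists_far_bound hm₀ hm₁ hn1 hψ hψc hψ₀ hC hψL h₁ h₂
  obtain ⟨C₁, hC₁, hann⟩ := exists_integral_annulus_le (n := n) hm₀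
    (K := κ ^ m + 1) (by positivity) hn2 hζ₀ hζle hζin hζout
  obtain ⟨C₂, hC₂, hback⟩ := exists_backward_bound (lam := lam) (ξ := ξ) (k := k) (u₀ := u₀)
    hm₀ hm₁ hn1 hζ hζc hζ₀ hζin hC hζL hC₁
  obtain ⟨C₃, hC₃, hflux⟩ := exists_flux_bound (lam := lam) (ξ := ξ) (k := k) (u₀ := u₀)
    hm₀ hm₁ hn1 hη hζ hζc hζ₀ hC hηL hC₂
  obtain ⟨C₄, hC₄, hsmall⟩ := exists_flux_small hm₀ hlam₀ hη hζin hζout hC hηL hηL'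
  refine ⟨ψ, C', hC', hψ, hψc, hψ₀, hψ₁, fun R T hR hRT => ?_⟩
  set e := (n : ℝ) - ((n : ℝ) - 2) / m with he_def
  have hψR := contDiff_rescale hψ 0 R
  have hψRc := hasCompactSupport_rescale hψc 0 hR
  set Φ : ℝ → ℝ := fun s => ∫ x, |u₁ x s - u₂ x s| * rescale ψ 0 R x with hΦ
  have hw := h₁.continuousL1Loc.sub h₂.continuousL1Loc
  have hΦc : ContinuousOn Φ (Ici 0) := hw.continuousOn_integral hψR.continuous hψRc
  have hΦ₀ : Φ 0 = 0 := by
    refine integral_eq_zero_of_ae ?_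
    filter_upwards [ae_ne_point hn1 (ξ 0)] with x hx
    simp [h₁.initial x hx, h₂.initial x hx]
  set F : ℝ → ℝ := fun s => C' * ((R⁻¹) ^ 2 * R ^ ((n : ℝ) * (1 - m))) * Φ s ^ m with hF
  have hFc : ContinuousOn F (Ici 0) :=
    continuousOn_const.mul (hΦc.rpow_const fun _ _ => Or.inr hm₀.le)
  set z : EuclideanSpace ℝ (Fin n) → ℝ → ℝ := fun x τ => u₁ x τ ^ m - u₂ x τ ^ m with hz
  have hzc : ContinuousOn (fun p : EuclideanSpace ℝ (Fin n) × ℝ => z p.1 p.2)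
      {p | p.1 ≠ ξ p.2 ∧ 0 ≤ p.2} :=
    (h₁.continuousOn.rpow_const fun _ _ => Or.inr hm₀.le).sub
      (h₂.continuousOn.rpow_const fun _ _ => Or.inr hm₀.le)
  -- The bad times. These sets decrease, and their intersection is empty since the asymptotics hold
  -- at every time, so their measures tend to zero.
  set V : ℕ → Set ℝ := fun N => Icc 0 T \ goodTimes z ξ lam N with hV
  have hVm : ∀ N, MeasurableSet (V N) := fun N => by
    have : V N = Icc 0 T \ (Icc 0 T ∩ goodTimes z ξ lam N) := by
      rw [hV]; simp
    rw [this]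
    exact measurableSet_Icc.diff (isClosed_Icc_inter_goodTimes hξ hzc T N).measurableSet
  have hVfin : ∀ N, volume (V N) ≠ ⊤ := fun N =>
    measure_ne_top_of_subset sdiff_subset isCompact_Icc.measure_lt_top.ne
  have hVlim : Tendsto (fun N => volume.real (V N)) atTop (𝓝 0) := by
    have hempty : ⋂ N, V N = ∅ := by
      refine eq_empty_iff_forall_notMem.2 fun τ hτ => ?_
      rw [mem_iInter] at hτ
      have hτ0 : 0 ≤ τ := (hτ 0).1.1
      obtain ⟨N, _, r, hr, hle⟩ := (h₁.asymptotics τ hτ0).exists_abs_sub_le (h₂.asymptotics τ hτ0)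
      obtain ⟨M, hM⟩ := exists_mem_goodTimes (z := z) hr hle
      exact (hτ M).2 hM
    have h := tendsto_measure_iInter_atTop (μ := volume) (s := V)
      (fun N => (hVm N).nullMeasurableSet)
      (fun M N hMN => sdiff_subset_sdiff_right (monotone_goodTimes hMN)) ⟨0, hVfin 0⟩
    rw [hempty, measure_empty] at h
    have := (ENNReal.tendsto_toReal ENNReal.zero_ne_top).comp h
    simpa [Function.comp_def, Measure.real] using this
  intro t₀ ht₀
  have hclaim : ∀ N : ℕ, Φ t₀ ≤ (∫ s in (0 : ℝ)..t₀, F s) + C₃ * volume.real (V N) := by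
    intro N
    set I : ℝ → ℝ := fun s => C₃ * (V N).indicator (fun _ => (1 : ℝ)) s with hI
    have hIint : ∀ a b, IntervalIntegrable I volume a b := fun a b => by
      have : Integrable I :=
        ((integrable_indicator_iff (hVm N)).2 (integrableOn_const (hVfin N))).const_mul C₃
      exact this.intervalIntegrable
    have hFint : ∀ a b, 0 ≤ a → 0 ≤ b → IntervalIntegrable F volume a b := fun a b ha hb =>
      (hFc.mono fun s hs => (le_min ha hb).trans hs.1).intervalIntegrable
    set G : ℝ → ℝ := fun s => F s + I s with hG
    have hGint : ∀ a b, 0 ≤ a → 0 ≤ b → IntervalIntegrable G volume a b := fun a b ha hb =>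
      (hFint a b ha hb).add (hIint a b)
    have hdec := le_of_left_increments_le (f := fun s => Φ s - ∫ τ in (0 : ℝ)..s, G τ) ht₀.1 ?_ ?_
    · simp only [intervalIntegral.integral_same, hΦ₀, sub_zero] at hdec
      have hIle : ∫ s in (0 : ℝ)..t₀, I s ≤ C₃ * volume.real (V N) := by
        rw [intervalIntegral.integral_const_mul, intervalIntegral.integral_of_le ht₀.1,
          integral_indicator (hVm N), setIntegral_const, smul_eq_mul, mul_one]
        refine mul_le_mul_of_nonneg_left ?_ hC₃
        exact ENNReal.toReal_mono (hVfin N) (Measure.restrict_apply_le _ _)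
      have : ∫ s in (0 : ℝ)..t₀, G s = (∫ s in (0 : ℝ)..t₀, F s) + ∫ s in (0 : ℝ)..t₀, I s :=
        intervalIntegral.integral_add (hFint 0 t₀ le_rfl ht₀.1) (hIint 0 t₀)
      linarith
    · refine (hΦc.mono fun s hs => hs.1).sub ?_
      have := intervalIntegral.continuousOn_primitive_interval' (hGint 0 t₀ le_rfl ht₀.1)
        left_mem_uIcc
      rwa [uIcc_of_le ht₀.1] at this
    · intro t ht c hc
      have ht0 : 0 ≤ t := ht.1.le
      have htT : t ∈ Icc 0 T := ⟨ht0, ht.2.trans ht₀.2⟩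
      -- The radii, `M` and `D` depend on `t`. This is harmless because the criterion asks only for
      -- small `h` at each fixed `t`.
      obtain ⟨r₁, hr₁, hu₁⟩ := (h₁.asymptotics t ht0).exists_rpow_le hm₀ hlam (hk₀ t ht0) (hkκ t ht0)
      obtain ⟨r₂, hr₂, hu₂⟩ := (h₂.asymptotics t ht0).exists_rpow_le hm₀ hlam (hk₀ t ht0) (hkκ t ht0)
      obtain ⟨M, hM, r₃, hr₃, hu₃⟩ :=
        (h₁.asymptotics t ht0).exists_abs_sub_le (h₂.asymptotics t ht0)
      obtain ⟨D, hD, hinner⟩ := exists_integral_ball_le (r := min (min r₁ r₂) r₃) hm₀ hm₁ hlam hn1 he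
        hη₀ hηle hη₂ (by positivity : 0 ≤ κ ^ m + 1) hM.le (h₁.pos t ht0) (h₂.pos t ht0)
        (fun x hx hxr => hu₁ x hx (hxr.trans_le ((min_le_left _ _).trans (min_le_left _ _))))
        (fun x hx hxr => hu₂ x hx (hxr.trans_le ((min_le_left _ _).trans (min_le_right _ _))))
        (fun x hx hxr => hu₃ x hx (hxr.trans_le (min_le_right _ _)))
      have hρ : 0 < min (min (min r₁ r₂) r₃) (min (1 / ((N : ℝ) + 1)) 1) := by positivity
      have hev : ∀ᶠ ε in 𝓝[>] (0 : ℝ), (Φ t - ∫ τ in (0 : ℝ)..t, G τ) -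
          (Φ (t - ε ^ e) - ∫ τ in (0 : ℝ)..(t - ε ^ e), G τ) ≤ c * ε ^ e := by
        filter_upwards [self_mem_nhdsWithin, hmove,
          eventually_mul_rpow_le (D := 5) one_pos (half_pos hρ),
          eventually_mul_rpow_le (D := 1) he (half_pos ht.1),
          eventually_mul_rpow_le (D := D + C₄ * N) (q := (n : ℝ) - 2 - lam) (by linarith) hc]
          with ε hε hmv h5 hεt hsm
        have hε0 : 0 < ε := hε
        rw [Real.rpow_one] at h5
        rw [one_mul] at hεt
        have h5' := h5.trans_lt (half_lt_self hρ)
        have hA := h5'.trans_le (min_le_left _ _)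
        have hA₃ := hA.trans_le (min_le_right _ _)
        have hA₁ := (hA.trans_le (min_le_left _ _)).trans_le (min_le_left _ _)
        have hA₂ := (hA.trans_le (min_le_left _ _)).trans_le (min_le_right _ _)
        have hB₁ := (h5'.trans_le (min_le_right _ _)).trans_le (min_le_left _ _)
        have hB₂ := (h5'.trans_le (min_le_right _ _)).trans_le (min_le_right _ _)
        set h := ε ^ e with hh
        have hh0 : 0 < h := by positivity
        have hht : h < t := by linarith [ht.1]
        have hξt : ∀ τ ∈ Icc (t - h) t, ‖ξ τ - ξ t‖ ≤ ε / 4 := fun τ hτ =>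
          hmv τ t (by linarith [hτ.1]) ht0 (by
            rw [abs_sub_comm, abs_of_nonneg (by linarith [hτ.2])]
            linarith [hτ.1])
        have hY₁ := hback u₁ h₁ t ε hε0 hht hξt
          (hann (ξ t) (fun x => u₁ x t) r₁ ε hε0 (by linarith) (h₁.pos t ht0) hu₁)
        have hY₂ := hback u₂ h₂ t ε hε0 hht hξt
          (hann (ξ t) (fun x => u₂ x t) r₂ ε hε0 (by linarith) (h₂.pos t ht0) hu₂)
        have hstep := integral_abs_sub_le_add (s := t - h) (t := t) (p := ξ t) (R := R) (ε := ε)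
          (g := fun τ => G τ + C₄ * N * ε ^ ((n : ℝ) - 2 - lam)) hm₀ h₁ h₂ hψR hψRc
          (fun x => hψ₀ _) (fun x hx => rescale_eq_one hψ₁ hR (by simpa using hx))
          (contDiff_rescale hη (ξ t) ε) (hasCompactSupport_rescale hηc (ξ t) hε0)
          (fun x => hη₀ _) (fun x => hηle _) (fun x hx => rescale_eq_one hη₁ hε0 hx)
          (fun x hx => rescale_eq_zero hη₂ hε0 hx) hε0 (by linarith [hRT t htT])
          (by linarith) (by linarith) hξt
          ((hGint _ _ (by linarith) ht0).add intervalIntegrable_const) ?_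
        · rw [intervalIntegral.integral_add (hGint _ _ (by linarith) ht0) intervalIntegrable_const,
            intervalIntegral.integral_const, smul_eq_mul, sub_sub_cancel] at hstep
          have hadj := intervalIntegral.integral_add_adjacent_intervals
            (hGint 0 (t - h) le_rfl (by linarith)) (hGint (t - h) t (by linarith) ht0)
          have hin := hinner ε hε0 (by
            have := lt_min (lt_min hA₁ hA₂) hA₃
            linarith)
          -- The inner mass is now `h` times the vanishing factor `ε^(n-2-lam)`, of the same form as
          -- the flux collected at good times over the window.
          rw [Real.rpow_add hε0, ← he_def, ← hh] at hin
          have hfin : (D + C₄ * N) * ε ^ ((n : ℝ) - 2 - lam) * h ≤ c * h :=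
            mul_le_mul_of_nonneg_right hsm hh0.le
          change Φ t ≤ Φ (t - h) + _ + _ at hstep
          nlinarith
        · intro τ hτ
          have hτ0 : 0 ≤ τ := by linarith [hτ.1]
          have hτT : τ ∈ Icc 0 T := ⟨hτ0, hτ.2.trans htT.2⟩
          have h1 := hfar R τ hR hτ0
          have hsm0 : 0 ≤ C₄ * N * ε ^ ((n : ℝ) - 2 - lam) := by positivity
          -- At a good time the flux is small with `ε`. At a bad time the universal bound `C₃` is
          -- charged to `I`, whose total integral is at most `C₃ |V N|`.
          by_cases hgood : τ ∈ goodTimes z ξ lam N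
          · have h2 := hsmall (fun x => z x τ) (ξ t) (ξ τ) ε (1 / ((N : ℝ) + 1)) N hε0 hB₁
              (by positivity) (hξt τ hτ) fun y hy hyr => by
                have := hgood (y - ξ τ) (sub_ne_zero.2 hy) hyr
                simpa using this
            have h3 : I τ = 0 := by
              have : τ ∉ V N := fun hτV => hτV.2 hgood
              simp [hI, this]
            simp only [hG, h3, add_zero]
            exact add_le_add h1 h2
          · have h2 := hflux u₁ u₂ h₁ h₂ (ξ t) τ ε hε0 hτ0 (hY₁ τ hτ) (hY₂ τ hτ)
            have h3 : I τ = C₃ := by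
              have : τ ∈ V N := ⟨hτT, hgood⟩
              simp [hI, this]
            simp only [hG, h3]
            have : F τ + C₃ ≤ F τ + C₃ + C₄ * N * ε ^ ((n : ℝ) - 2 - lam) := by linarith
            exact (add_le_add h1 h2).trans this
      exact (tendsto_rpow_nhdsGT_zero he).frequently hev.frequently
  have hlim : Tendsto (fun N => (∫ s in (0 : ℝ)..t₀, F s) + C₃ * volume.real (V N)) atTop
      (𝓝 (∫ s in (0 : ℝ)..t₀, F s)) := by
    simpa using (hVlim.const_mul C₃).const_add (∫ s in (0 : ℝ)..t₀, F s)
  exact ge_of_tendsto' hlim hclaim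

end Main

/-! ### Displacement of the curve within the intrinsic time. -/

section Curves

variable {n : ℕ} {m : ℝ} {ξ : ℝ → EuclideanSpace ℝ (Fin n)}

theorem IsStandingCurve.continuousOn (h : IsStandingCurve n m ξ) : ContinuousOn ξ (Ici 0) := by
  obtain ⟨_, ξ₀, hξ₀⟩ := h
  exact (continuousOn_const (c := ξ₀)).congr fun t ht => hξ₀ t ht

theorem IsStandingCurve.eventually_norm_sub_le (h : IsStandingCurve n m ξ) :
    ∀ᶠ ε in 𝓝[>] (0 : ℝ), ∀ s t, 0 ≤ s → 0 ≤ t →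
      |s - t| ≤ ε ^ ((n : ℝ) - ((n : ℝ) - 2) / m) → ‖ξ s - ξ t‖ ≤ ε / 4 := by
  obtain ⟨_, ξ₀, hξ₀⟩ := h
  filter_upwards [self_mem_nhdsWithin] with ε hε s t hs ht _
  have : (0 : ℝ) < ε := hε
  rw [hξ₀ s hs, hξ₀ t ht, sub_self, norm_zero]
  linarith

/-- The curve moves slowly compared with the intrinsic time scale of the singularity. -/
theorem IsMovingCurve.eventually_norm_sub_le (h : IsMovingCurve n m ξ) (hn : 3 ≤ n) (hm₀ : 0 < m) :
    ∀ᶠ ε in 𝓝[>] (0 : ℝ), ∀ s t, 0 ≤ s → 0 ≤ t →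
      |s - t| ≤ ε ^ ((n : ℝ) - ((n : ℝ) - 2) / m) → ‖ξ s - ξ t‖ ≤ ε / 4 := by
  have hn' : (3 : ℝ) ≤ n := by exact_mod_cast hn
  obtain ⟨L, β, hL, hβ, hdecay⟩ := h.decay
  -- `m > (n-2)/(n-1)` says exactly that the intrinsic time exponent exceeds one, so a curve of
  -- bounded speed moves only `O(ε^e) = o(ε)` during the time `ε^e`.
  have he : 0 < (n : ℝ) - ((n : ℝ) - 2) / m - 1 := by
    have h1 := h.exponent
    rw [div_lt_iff₀ (by linarith)] at h1
    have : ((n : ℝ) - 2) / m < n - 1 := by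
      rw [div_lt_iff₀ hm₀]
      linarith
    linarith
  have hd : ∀ t ∈ Ici (0 : ℝ), ‖derivWithin ξ (Ici 0) t‖ ≤ L := fun t ht => by
    refine (hdecay t ht).trans (mul_le_of_le_one_right hL.le (Real.exp_le_one_iff.2 ?_))
    have : 0 ≤ β * t := mul_nonneg hβ.le ht
    linarith
  filter_upwards [self_mem_nhdsWithin,
    eventually_mul_rpow_le (D := L) he (by norm_num : (0 : ℝ) < 1 / 4)] with ε hε hsm s t hs ht hst
  have hε0 : 0 < ε := hε
  have h1 := Convex.norm_image_sub_le_of_norm_derivWithin_le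
    (h.contDiffOn.differentiableOn (by norm_num)) hd (convex_Ici 0) ht hs
  calc ‖ξ s - ξ t‖ ≤ L * ‖s - t‖ := h1
    _ ≤ L * ε ^ ((n : ℝ) - ((n : ℝ) - 2) / m) := by
        gcongr
        exact hst
    _ = L * ε ^ ((n : ℝ) - ((n : ℝ) - 2) / m - 1) * ε := by
        rw [mul_assoc, ← Real.rpow_add_one hε0.ne', sub_add_cancel]
    _ ≤ 1 / 4 * ε := by gcongr
    _ = ε / 4 := by ring

theorem IsMovingCurve.exponent_lt (h : IsMovingCurve n m ξ) (hn : 3 ≤ n) :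
    ((n : ℝ) - 2) / n < m := by
  have hn' : (3 : ℝ) ≤ n := by exact_mod_cast hn
  refine lt_trans ?_ h.exponent
  exact div_lt_div_of_pos_left (by linarith) (by linarith) (by linarith)

end Curves

/-! ### Conclusion: the cutoff radius tends to infinity. -/

theorem theorem1 (n : ℕ) (hn : 3 ≤ n) (m lam μ ν : ℝ) (hm₀ : 0 < m) (hm₁ : m < 1)
    (ξ : ℝ → EuclideanSpace ℝ (Fin n)) (k : ℝ → ℝ) (u₀ : EuclideanSpace ℝ (Fin n) → ℝ)
    (hξ : IsStandingCurve n m ξ ∨ (IsMovingCurve n m ξ ∧ ((n : ℝ) - 2) / m - 1 < lam))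
    (hlam : 0 < lam) (hlamμ : lam < μ) (hμ : μ < (n : ℝ) - 2) (hν : (n : ℝ) - 2 < ν)
    (hk : IsStrength k)
    (hu₀ : IsInitialDatum m (k 0) lam μ ν (ξ 0) u₀)
    (u₁ u₂ : EuclideanSpace ℝ (Fin n) → ℝ → ℝ)
    (h₁ : IsSingularSolution m lam ξ k u₀ u₁)
    (h₂ : IsSingularSolution m lam ξ k u₀ u₂)
    (h₀ : ∀ x, x ≠ ξ 0 → u₁ x 0 = u₂ x 0) :
    ∀ t : ℝ, 0 < t → ∀ x, x ≠ ξ t → u₁ x t = u₂ x t := by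
  have hn' : (3 : ℝ) ≤ n := by exact_mod_cast hn
  have hmn : ((n : ℝ) - 2) / n < m := hξ.elim (fun h => h.1) fun h => h.1.exponent_lt hn
  have hξc : ContinuousOn ξ (Ici 0) :=
    hξ.elim (fun h => h.continuousOn) fun h => h.1.contDiffOn.continuousOn
  have hmove := hξ.elim (fun h => h.eventually_norm_sub_le)
    fun h => h.1.eventually_norm_sub_le hn hm₀
  -- The inequality `n - 2 < m n` is used twice: near the curve as positivity of `n - (n-2)/m`, and
  -- at infinity as `n(1-m) < 2`.
  rw [div_lt_iff₀ (by linarith)] at hmn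
  have he : 0 < (n : ℝ) - ((n : ℝ) - 2) / m := by
    rw [sub_pos, div_lt_iff₀ hm₀]
    linarith
  obtain ⟨κ, hκ, hkb⟩ := hk.bounds
  obtain ⟨ψ, C, hC, hψ, hψc, hψ₀, hψ₁, hmain⟩ := exists_integral_abs_sub_le hn hm₀ hm₁ he hlam
    (hlamμ.trans hμ) (fun t ht => (inv_pos.2 hκ).le.trans (hkb t ht).1) (fun t ht => (hkb t ht).2)
    hξc hmove h₁ h₂
  intro T hT x₀ hx₀
  have hw := h₁.continuousL1Loc.sub h₂.continuousL1Loc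
  obtain ⟨B, hB⟩ := isCompact_Icc.exists_bound_of_continuousOn
    (hξc.mono fun s (hs : s ∈ Icc 0 T) => hs.1)
  have hbound : ∀ R : ℝ, 0 < R → B + 1 ≤ R → ∫ x, |u₁ x T - u₂ x T| * rescale ψ 0 R x ≤
      (T * (C * R ^ ((n : ℝ) * (1 - m) - 2))) ^ (1 - m)⁻¹ := by
    intro R hR hBR
    set Φ : ℝ → ℝ := fun s => ∫ x, |u₁ x s - u₂ x s| * rescale ψ 0 R x with hΦ
    have hΦc : ContinuousOn Φ (Icc 0 T) := (hw.continuousOn_integral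
      (contDiff_rescale hψ 0 R).continuous (hasCompactSupport_rescale hψc 0 hR)).mono
        fun s hs => hs.1
    have hΦ0 : ∀ s, 0 ≤ Φ s := fun s => integral_nonneg fun x => mul_nonneg (abs_nonneg _) (hψ₀ _)
    -- At the maximum, `Φ s ≤ T c (Φ s)^m`. A sublinear inequality of this kind does not force `Φ =
    -- 0`; it only bounds `Φ` by `(T c)^(1/(1-m))`, and the vanishing comes from `c → 0` as `R → ∞`.
    obtain ⟨s, hs, hmax⟩ := isCompact_Icc.exists_isMaxOn ⟨T, right_mem_Icc.2 hT.le⟩ hΦc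
    set c := C * ((R⁻¹) ^ 2 * R ^ ((n : ℝ) * (1 - m))) with hc
    have hc0 : 0 ≤ c := by positivity
    have hcR : c = C * R ^ ((n : ℝ) * (1 - m) - 2) := by
      rw [hc, Real.rpow_sub hR, inv_pow]
      norm_cast
      ring
    rw [← hcR]
    refine (hmax (right_mem_Icc.2 hT.le)).trans ?_
    have h1 : Φ s ≤ T * c * Φ s ^ m := by
      refine (hmain R T hR (fun τ hτ => by linarith [hB τ hτ]) s hs).trans ?_
      have h2 : ∫ τ in (0 : ℝ)..s, c * Φ τ ^ m ≤ ∫ _ in (0 : ℝ)..s, c * Φ s ^ m := by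
        refine intervalIntegral.integral_mono_on hs.1 ?_ intervalIntegrable_const fun τ hτ => ?_
        · refine ContinuousOn.intervalIntegrable ?_
          rw [uIcc_of_le hs.1]
          exact continuousOn_const.mul ((hΦc.mono (Icc_subset_Icc_right hs.2)).rpow_const
            fun _ _ => Or.inr hm₀.le)
        · exact mul_le_mul_of_nonneg_left (Real.rpow_le_rpow (hΦ0 τ)
            (hmax ⟨hτ.1, hτ.2.trans hs.2⟩) hm₀.le) hc0
      refine h2.trans ?_
      rw [intervalIntegral.integral_const, smul_eq_mul, sub_zero, mul_assoc T]
      exact mul_le_mul_of_nonneg_right hs.2 (mul_nonneg hc0 (Real.rpow_nonneg (hΦ0 s) _))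
    rcases (hΦ0 s).eq_or_lt with h3 | h3
    · rw [← h3]; positivity
    · have h4 : Φ s ^ (1 - m) ≤ T * c := by
        rw [Real.rpow_sub h3, Real.rpow_one, div_le_iff₀ (by positivity)]
        exact h1
      have h5 := Real.rpow_le_rpow (by positivity) h4 (inv_nonneg.2 (sub_nonneg.2 hm₁.le))
      rwa [← Real.rpow_mul h3.le, mul_inv_cancel₀ (by linarith), Real.rpow_one] at h5
  have hlim : Tendsto (fun R : ℝ => (T * (C * R ^ ((n : ℝ) * (1 - m) - 2))) ^ (1 - m)⁻¹) atTop
      (𝓝 0) := by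
    have h1 := tendsto_rpow_neg_atTop (y := 2 - (n : ℝ) * (1 - m)) (by linarith)
    have h2 := ((h1.const_mul C).const_mul T).rpow_const
      (Or.inr (inv_nonneg.2 (sub_nonneg.2 hm₁.le)))
    simpa [Real.zero_rpow (inv_ne_zero (sub_ne_zero.2 hm₁.ne')), neg_sub] using h2
  set r := ‖x₀‖ + 1 with hr
  have hIon : IntegrableOn (fun x => |u₁ x T - u₂ x T|) (Metric.ball 0 r) :=
    ((hw.locallyIntegrable T hT.le).integrableOn_isCompact
      (isCompact_closedBall 0 r)).abs.mono_measure
      (Measure.restrict_mono Metric.ball_subset_closedBall le_rfl)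
  have hzero : ∫ x in Metric.ball 0 r, |u₁ x T - u₂ x T| = 0 := by
    refine le_antisymm (ge_of_tendsto hlim ?_) (integral_nonneg fun x => abs_nonneg _)
    filter_upwards [eventually_gt_atTop 0, eventually_ge_atTop (B + 1), eventually_ge_atTop r]
      with R hR hBR hrR
    refine le_trans ?_ (hbound R hR hBR)
    rw [← integral_indicator Metric.isOpen_ball.measurableSet]
    refine integral_mono ((integrable_indicator_iff Metric.isOpen_ball.measurableSet).2 hIon)
      (hw.integrable_abs_mul (contDiff_rescale hψ 0 R).continuous
        (hasCompactSupport_rescale hψc 0 hR) hT.le) fun x => ?_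
    by_cases hx : x ∈ Metric.ball 0 r
    · rw [indicator_of_mem hx]
      rw [mem_ball_zero_iff] at hx
      rw [rescale_eq_one hψ₁ hR (by rw [sub_zero]; linarith), mul_one]
    · rw [indicator_of_notMem hx]
      exact mul_nonneg (abs_nonneg _) (hψ₀ _)
  have hae : (fun x => u₁ x T - u₂ x T) =ᵐ[volume.restrict (Metric.ball 0 r)] fun _ => 0 := by
    have := (integral_eq_zero_iff_of_nonneg (fun x => abs_nonneg _) hIon).1 hzero
    filter_upwards [this] with x hx
    exact abs_eq_zero.1 hx
  have hcont : ∀ {u : EuclideanSpace ℝ (Fin n) → ℝ → ℝ}, IsSingularSolution m lam ξ k u₀ u →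
      ContinuousOn (fun x => u x T) (Metric.ball 0 r ∩ {ξ T}ᶜ) := fun h =>
    h.continuousOn.comp (f := fun x => (x, T)) (by fun_prop) fun x hx => ⟨hx.2, hT.le⟩
  -- Continuity off `ξ T` upgrades equality almost everywhere to equality at `x₀`.
  have := Measure.eqOn_open_of_ae_eq
    (ae_restrict_of_ae_restrict_of_subset inter_subset_left hae)
    (Metric.isOpen_ball.inter isOpen_compl_singleton) ((hcont h₁).sub (hcont h₂))
    continuousOn_const
    (⟨by rw [mem_ball_zero_iff]; linarith, hx₀⟩ : x₀ ∈ Metric.ball 0 r ∩ {ξ T}ᶜ)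
  exact sub_eq_zero.1 this
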